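/- **Setting.** A projective geometry $\mathbb P$ is a set of points with a family of point sets called lines such that (i) any two distinct points $p,q$ lie on a unique line $pq$, (ii) every line has at least three points, and (iii) if $p,q,r$ are noncollinear, $p'\in qr$ and $q'\in pr$, then $pp'\cap qq'\ne\emptyset$. It may be non-Desarguesian, of infinite dimension, empty or a single point. A *flat* is a point set that contains the whole line through any two of its points; the *span* of a point set is the smallest flat containing it; a point set is *independent* if none of its points lies in the span of the others. For a point set $A$, $M(A)$ is the matroid on $A$ whose independent sets are the independent subsets of $A$. Let $\hat N$ be an independent point set of $\mathbb P$. An *edge line* is a line $pq$ with distinct $p,q\in\hat N$. Let $\hat E^{\bullet}(\hat N)$ be the union of $\hat N$ and all edge lines, and let $\hat E\subseteq\hat E^{\bullet}(\hat N)$. A *cross-flat* is a flat disjoint from $\hat N$. Define a graph $\Gamma=(N,E)$ with $N$ and $E$ in one-to-one correspondence $v\mapsto\hat v$, $e\mapsto\hat e$ with $\hat N$ and $\hat E$: if $\hat e=\hat v\in\hat N$, then $e$ is a half edge at $v$ (an edge with the single endpoint $v$); if $\hat e\notin\hat N$, then $e$ is a link whose two endpoints are the nodes $v,w$ with $\hat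 e\in\hat v\hat w$. For $S\subseteq E$ put $\hat S=\{\hat e: e\in S\}$. A *circle* is the edge set of a simple closed path of links (of length at least $2$; two parallel links form a circle). Let $\mathcal B$ be the class of circles $C$ of $\Gamma$ such that $\hat C$ lies in a cross-flat, and let $\Omega(\hat N,\hat E)=(\Gamma,\mathcal B)$. A theta graph is the union of three internally disjoint paths with the same two distinct endpoints. A graph with a class $\mathcal B$ of circles is a *biased graph* if no theta subgraph contains exactly two circles of $\mathcal B$; circles in $\mathcal B$ are *balanced*, and an edge set is *balanced* if it contains no half edge and all circles in it are balanced. The *frame matroid* $G(\Omega)$ of a biased graph $\Omega$ is the matroid on its edge set whose circuits are exactly: the balanced circles; the theta graphs that contain no balanced circle; the unions of two edge-disjoint unbalanced figures (half edges or unbalanced circles) having exactly one common node; and the unions of two node-disjoint unbalanced figures and a path joining them that meets each figure only in one endpoint of the path. **Theorem.** (a) $\Omega(\hat N,\hat E)$ is a biased graph; its frame matroid $G(\Omega(\hat N,\hat E))$ exists, and $e\mapsto\hat e$ is an isomorphism $G(\Omega(\hat N,\hat E))\cong M(\hat E)$. (b) The sets $S\subseteq E$ that are closed in $G(\Omega(\hat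 N,\hat E))$ and balanced are exactly the edge sets corresponding to the intersections of $\hat E$ with cross-flats, that is, the sets $\{e\in E:\hat e\in t\}$ for $t$ a cross-flat. -/

import Mathlib

/-! ### Axiomatic projective geometry -/

/-- A projective geometry in the sense of Veblen and Young on the point set `P`: a set of lines
such that two distinct points lie on exactly one line, every line has at least three points, and
for noncollinear `p, q, r` with `p'` on the line `qr` and `q'` on the line `pr` the lines `pp'` and
`qq'` meet. The empty geometry and the one-point geometry are allowed, and so are infinite
dimension and non-Desarguesian planes. -/
structure ProjGeom (P : Type*) where
  /-- The lines, as point sets. -/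
  lines : Set (Set P)
  existsUnique_line : ∀ p q : P, p ≠ q → ∃! l, l ∈ lines ∧ p ∈ l ∧ q ∈ l
  three_points : ∀ l ∈ lines, ∃ a ∈ l, ∃ b ∈ l, ∃ c ∈ l, a ≠ b ∧ a ≠ c ∧ b ≠ c
  veblen : ∀ p q r : P, (¬ ∃ l ∈ lines, p ∈ l ∧ q ∈ l ∧ r ∈ l) →
    ∀ p' q' : P, ∀ a ∈ lines, ∀ b ∈ lines, ∀ c ∈ lines, ∀ d ∈ lines,
      q ∈ a → r ∈ a → p' ∈ a → p ∈ b → r ∈ b → q' ∈ b →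
      p ∈ c → p' ∈ c → q ∈ d → q' ∈ d → (c ∩ d).Nonempty

namespace ProjGeom

/-- A flat (subspace): a point set that contains the whole line through any two of its points. -/
def IsFlat {P : Type*} (G : ProjGeom P) (t : Set P) : Prop :=
  ∀ p ∈ t, ∀ q ∈ t, p ≠ q → ∀ l ∈ G.lines, p ∈ l → q ∈ l → l ⊆ t

/-- The span of a point set: the smallest flat containing it. -/
def span {P : Type*} (G : ProjGeom P) (S : Set P) : Set P :=
  ⋂₀ {t | G.IsFlat t ∧ S ⊆ t}

/-- Projective independence: no point lies in the span of the others. -/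
def Indep {P : Type*} (G : ProjGeom P) (S : Set P) : Prop :=
  ∀ p ∈ S, p ∉ G.span (S \ {p})

theorem subset_span {P : Type*} (G : ProjGeom P) (S : Set P) : S ⊆ G.span S :=
  fun _ hx _ ht => ht.2 hx

theorem isFlat_span {P : Type*} (G : ProjGeom P) (S : Set P) : G.IsFlat (G.span S) := by
  intro p hp q hq hpq l hl hpl hql x hx t ht
  exact ht.1 p (hp t ht) q (hq t ht) hpq l hl hpl hql hx

theorem span_subset {P : Type*} (G : ProjGeom P) {S t : Set P} (ht : G.IsFlat t) (h : S ⊆ t) :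
    G.span S ⊆ t :=
  fun _ hx => hx t ⟨ht, h⟩

theorem span_mono {P : Type*} (G : ProjGeom P) {S T : Set P} (h : S ⊆ T) :
    G.span S ⊆ G.span T :=
  G.span_subset (G.isFlat_span T) (h.trans (G.subset_span T))

theorem line_eq {P : Type*} (G : ProjGeom P) {p q : P} (h : p ≠ q) {l m : Set P}
    (hl : l ∈ G.lines) (hm : m ∈ G.lines) (hpl : p ∈ l) (hql : q ∈ l) (hpm : p ∈ m)
    (hqm : q ∈ m) : l = m :=
  (G.existsUnique_line p q h).unique ⟨hl, hpl, hql⟩ ⟨hm, hpm, hqm⟩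

theorem exists_line {P : Type*} (G : ProjGeom P) {p q : P} (h : p ≠ q) :
    ∃ l ∈ G.lines, p ∈ l ∧ q ∈ l :=
  (G.existsUnique_line p q h).exists

/-- The other usual form of the Veblen axiom: if the lines `ac` and `bd` meet, so do `ab` and
`cd`. -/
theorem veblen' {P : Type*} (G : ProjGeom P) {a b c d r : P} {m n k h : Set P}
    (hm : m ∈ G.lines) (hn : n ∈ G.lines) (hk : k ∈ G.lines) (hh : h ∈ G.lines)
    (hab : a ≠ b) (hcd : c ≠ d) (ham : a ∈ m) (hcm : c ∈ m) (hrm : r ∈ m)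
    (hbn : b ∈ n) (hdn : d ∈ n) (hrn : r ∈ n) (hak : a ∈ k) (hbk : b ∈ k)
    (hch : c ∈ h) (hdh : d ∈ h) : (k ∩ h).Nonempty := by
  by_cases hmn : m = n
  · subst hmn
    have h1 := G.line_eq hab hk hm hak hbk ham hbn
    exact ⟨c, h1 ▸ hcm, hch⟩
  by_cases har : a = r
  · subst har
    have h1 := G.line_eq hab hk hn hak hbk hrn hbn
    exact ⟨d, h1 ▸ hdn, hdh⟩
  by_cases hdr : d = r
  · subst hdr
    have h1 := G.line_eq hcd hh hm hch hdh hcm hrm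
    exact ⟨a, hak, h1 ▸ ham⟩
  refine G.veblen a d r ?_ b c n hn m hm k hk h hh hdn hrn hbn ham hrm hcm hak hbk hdh hch
  rintro ⟨l, hl, hal, hdl, hrl⟩
  exact hmn ((G.line_eq har hm hl ham hrm hal hrl).trans
    (G.line_eq hdr hl hn hdl hrl hdn hrn))

/-- Joining a point `q` to a nonempty flat `T`: every point of the span lies on a line through `q`
and a point of `T`. -/
theorem isFlat_cone {P : Type*} (G : ProjGeom P) {T : Set P} (hT : G.IsFlat T) {q : P}
    (hq : q ∉ T) :
    G.IsFlat {x | x = q ∨ ∃ s ∈ T, ∃ l ∈ G.lines, s ∈ l ∧ q ∈ l ∧ x ∈ l} := by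
  have key : ∀ s ∈ T, ∀ l ∈ G.lines, s ∈ l → q ∈ l → ∀ x ∈ l,
      x = q ∨ ∃ s ∈ T, ∃ l ∈ G.lines, s ∈ l ∧ q ∈ l ∧ x ∈ l :=
    fun s hs l hl hsl hql x hx => Or.inr ⟨s, hs, l, hl, hsl, hql, hx⟩
  rintro x hx y hy hxy l hl hxl hyl z hzl
  have hne : ∀ {s}, s ∈ T → s ≠ q := fun hs h => hq (h ▸ hs)
  by_cases hzq : z = q
  · exact Or.inl hzq
  rcases hx with rfl | ⟨s, hs, m, hm, hsm, hqm, hxm⟩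
  · rcases hy with rfl | ⟨s, hs, m, hm, hsm, hqm, hym⟩
    · exact absurd rfl hxy
    · exact key s hs m hm hsm hqm z (G.line_eq hxy hl hm hxl hyl hqm hym ▸ hzl)
  rcases hy with rfl | ⟨s', hs', n, hn, hsn, hqn, hyn⟩
  · exact key s hs m hm hsm hqm z (G.line_eq hxy hl hm hxl hyl hxm hqm ▸ hzl)
  by_cases hss : s = s'
  · subst hss
    have hmn := G.line_eq (hne hs) hm hn hsm hqm hsn hqn
    subst hmn
    exact key s hs m hm hsm hqm z (G.line_eq hxy hl hm hxl hyl hxm hyn ▸ hzl)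
  obtain ⟨t, ht, hst, hst'⟩ := G.exists_line hss
  have htT : t ⊆ T := hT s hs s' hs' hss t ht hst hst'
  obtain ⟨w, hwl, hwt⟩ : (l ∩ t).Nonempty :=
    G.veblen' hm hn hl ht hxy hss hxm hsm hqm hyn hsn hqn hxl hyl hst hst'
  obtain ⟨k, hk, hqk, hzk⟩ := G.exists_line (Ne.symm hzq)
  by_cases hsw : s = w
  · subst hsw
    by_cases hzs : z = s
    · exact key s hs m hm hsm hqm z (hzs ▸ hsm)
    by_cases hsx : s = x
    · subst hsx
      obtain ⟨v, hvk, hvt⟩ : (k ∩ t).Nonempty :=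
        G.veblen' hn hl hk ht (Ne.symm hzq) (Ne.symm hss) hqn hsn hyn hzl hxl hyl hqk hzk hst' hst
      exact key v (htT hvt) k hk hvk hqk z hzk
    · have hlm := G.line_eq hsx hl hm hwl hxl hsm hxm
      exact key s hs m hm hsm hqm z (hlm ▸ hzl)
  · obtain ⟨v, hvk, hvt⟩ : (k ∩ t).Nonempty :=
      G.veblen' hm hl hk ht (Ne.symm hzq) hsw hqm hsm hxm hzl hwl hxl hqk hzk hst hwt
    exact key v (htT hvt) k hk hvk hqk z hzk

theorem exchange {P : Type*} (G : ProjGeom P) {S : Set P} {p q : P}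
    (hp : p ∈ G.span (insert q S)) (hpS : p ∉ G.span S) : q ∈ G.span (insert p S) := by
  have hS : G.span S ⊆ G.span (insert p S) := G.span_mono (Set.subset_insert _ _)
  have hpp : p ∈ G.span (insert p S) := G.subset_span _ (Set.mem_insert _ _)
  by_cases hq : q ∈ G.span S
  · exact hS hq
  have h := G.span_subset (G.isFlat_cone (G.isFlat_span S) hq) (S := insert q S) ?_ hp
  · rcases h with rfl | ⟨s, hs, l, hl, hsl, hql, hpl⟩
    · exact hpp
    · exact G.isFlat_span _ s (hS hs) p hpp (fun h => hpS (h ▸ hs)) l hl hsl hpl hql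
  · rintro x (rfl | hx)
    · exact Or.inl rfl
    · have hx' := G.subset_span S hx
      obtain ⟨l, hl, h1, h2⟩ := G.exists_line (p := x) (q := q) (fun h => hq (h ▸ hx'))
      exact Or.inr ⟨x, hx', l, hl, h1, h2, h1⟩

theorem exists_finite_of_mem_span {P : Type*} (G : ProjGeom P) {S : Set P} {x : P}
    (hx : x ∈ G.span S) : ∃ F ⊆ S, F.Finite ∧ x ∈ G.span F := by
  refine G.span_subset (t := {x | ∃ F ⊆ S, F.Finite ∧ x ∈ G.span F}) ?_ ?_ hx
  · rintro p ⟨F, hF, hFf, hp⟩ q ⟨F', hF', hFf', hq⟩ hpq l hl hpl hql y hy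
    exact ⟨F ∪ F', Set.union_subset hF hF', hFf.union hFf',
      G.isFlat_span _ p (G.span_mono Set.subset_union_left hp) q
        (G.span_mono Set.subset_union_right hq) hpq l hl hpl hql hy⟩
  · intro y hy
    exact ⟨{y}, Set.singleton_subset_iff.2 hy, Set.finite_singleton y, G.subset_span _ rfl⟩

theorem Indep.subset {P : Type*} {G : ProjGeom P} {S T : Set P} (hT : G.Indep T) (h : S ⊆ T) :
    G.Indep S :=
  fun p hp hp' => hT p (h hp) (G.span_mono (Set.sdiff_subset_sdiff_left h) hp')

theorem indep_insert {P : Type*} {G : ProjGeom P} {S : Set P} {x : P} (hS : G.Indep S)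
    (hx : x ∉ G.span S) : G.Indep (insert x S) := by
  have hxS : x ∉ S := fun h => hx (G.subset_span S h)
  rintro p (rfl | hp) hps
  · rw [Set.insert_sdiff_of_mem _ (Set.mem_singleton p), Set.sdiff_singleton_eq_self hxS] at hps
    exact hx hps
  · have hxp : x ∉ ({p} : Set P) := fun h => hxS (by rwa [Set.mem_singleton_iff.1 h])
    rw [Set.insert_sdiff_of_notMem _ hxp] at hps
    have := G.exchange hps (hS p hp)
    rw [Set.insert_sdiff_singleton, Set.insert_eq_of_mem hp] at this
    exact hx this

theorem mem_span_of_not_indep_insert {P : Type*} {G : ProjGeom P} {S : Set P} {x : P}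
    (hS : G.Indep S) (hx : ¬ G.Indep (insert x S)) : x ∈ G.span S :=
  by_contra fun h => hx (indep_insert hS h)

theorem span_eq_univ_of_maximal {P : Type*} {G : ProjGeom P} {B : Set P}
    (hB : Maximal G.Indep B) : G.span B = Set.univ := by
  refine Set.eq_univ_of_forall fun x => by_contra fun hx => hx (G.subset_span B ?_)
  exact hB.2 (indep_insert hB.1 hx) (Set.subset_insert _ _) (Set.mem_insert _ _)

/-- The matroid of projective dependence on the set of all points. The matroid `M(A)` of a point set
`A` is its restriction `G.matroid ↾ A`. -/
noncomputable def matroid {P : Type*} (G : ProjGeom P) : Matroid P :=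
  (IndepMatroid.ofFinitary Set.univ G.Indep
    (fun p hp => absurd hp (Set.notMem_empty p))
    (fun _ _ hJ h => hJ.subset h)
    (by
      intro I B hI hIm hB
      by_contra! hcon
      have hBI : B ⊆ G.span I := by
        intro x hx
        by_cases hxI : x ∈ I
        · exact G.subset_span I hxI
        · exact mem_span_of_not_indep_insert hI (hcon x ⟨hx, hxI⟩)
      have huniv : G.span I = Set.univ := by
        refine Set.eq_univ_of_univ_subset ?_
        rw [← span_eq_univ_of_maximal hB]
        exact G.span_subset (G.isFlat_span I) hBI
      refine hIm ⟨hI, fun J hJ hIJ x hx => by_contra fun hxI => ?_⟩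
      have h1 : G.span I ⊆ G.span (J \ {x}) :=
        G.span_mono fun y hy => ⟨hIJ hy, fun h => hxI (Set.mem_singleton_iff.1 h ▸ hy)⟩
      exact hJ x hx (h1 (huniv ▸ Set.mem_univ x)))
    (by
      intro I hI p hp hps
      obtain ⟨F, hF, hFf, hpF⟩ := G.exists_finite_of_mem_span hps
      refine hI (insert p F) (Set.insert_subset hp (hF.trans Set.sdiff_subset)) (hFf.insert p) p
        (Set.mem_insert _ _) (G.span_mono ?_ hpF)
      exact fun y hy => ⟨Set.mem_insert_of_mem _ hy, (hF hy).2⟩)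
    (fun _ _ => Set.subset_univ _)).matroid

/-- The union of the edge lines `vw` (`v ≠ w` in `Nhat`). The set `Nhat` is added so that the single
point of a one-point `Nhat`, which has no edge lines, is not lost; otherwise it is in the union. -/
def fullEdgePoints {P : Type*} (G : ProjGeom P) (Nhat : Set P) : Set P :=
  Nhat ∪ {x | ∃ v ∈ Nhat, ∃ w ∈ Nhat, v ≠ w ∧ ∃ l ∈ G.lines, v ∈ l ∧ w ∈ l ∧ x ∈ l}

/-- A cross-flat of `Nhat`: a flat disjoint from `Nhat`. -/
def IsCrossFlat {P : Type*} (G : ProjGeom P) (Nhat t : Set P) : Prop :=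
  G.IsFlat t ∧ Disjoint t Nhat

end ProjGeom

/-! ### Graphs with links and half edges, and biased graphs -/

/-- A graph with node type `N` and edge type `E`, possibly infinite and with parallel edges. Each
edge is a half edge (one endpoint) or a link (two distinct endpoints). -/
structure HalfGraph (N E : Type*) where
  /-- The set of endpoints of an edge. -/
  ends : E → Set N
  half_or_link : ∀ e, (∃ v, ends e = {v}) ∨ ∃ v w, v ≠ w ∧ ends e = {v, w}

namespace HalfGraph

/-- `e` is a half edge. -/
def IsHalfEdge {N E : Type*} (Γ : HalfGraph N E) (e : E) : Prop :=
  ∃ v, Γ.ends e = {v}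

/-- `e` is a link with the distinct endpoints `v` and `w`. -/
def IsLink {N E : Type*} (Γ : HalfGraph N E) (e : E) (v w : N) : Prop :=
  v ≠ w ∧ Γ.ends e = {v, w}

/-- The set of nodes of the edges in `S`. -/
def nodes {N E : Type*} (Γ : HalfGraph N E) (S : Set E) : Set N :=
  ⋃ e ∈ S, Γ.ends e

/-- `Γ.IsPath u w X S`: there is a path (without repeated nodes) from `u` to `w` whose node set is
`X` and whose edge set is `S`. -/
inductive IsPath {N E : Type*} (Γ : HalfGraph N E) : N → N → Set N → Set E → Prop
  | nil (v : N) : IsPath Γ v v {v} ∅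
  | cons {u v w : N} {X : Set N} {S : Set E} {e : E} : Γ.IsLink e u v → IsPath Γ v w X S →
      u ∉ X → IsPath Γ u w (insert u X) (insert e S)

/-- A circle: the edge set of a simple closed path. Two parallel links form a circle. -/
def IsCircle {N E : Type*} (Γ : HalfGraph N E) (C : Set E) : Prop :=
  ∃ u w X S e, Γ.IsPath u w X S ∧ Γ.IsLink e u w ∧ e ∉ S ∧ C = insert e S

/-- (The edge set of) a theta graph: the union of three internally disjoint paths with the same two
distinct endpoints. -/
def IsTheta {N E : Type*} (Γ : HalfGraph N E) (T : Set E) : Prop :=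
  ∃ u w X₁ X₂ X₃ S₁ S₂ S₃, u ≠ w ∧
    Γ.IsPath u w X₁ S₁ ∧ Γ.IsPath u w X₂ S₂ ∧ Γ.IsPath u w X₃ S₃ ∧
    X₁ ∩ X₂ = {u, w} ∧ X₁ ∩ X₃ = {u, w} ∧ X₂ ∩ X₃ = {u, w} ∧
    Disjoint S₁ S₂ ∧ Disjoint S₁ S₃ ∧ Disjoint S₂ S₃ ∧ T = S₁ ∪ S₂ ∪ S₃

/-- `(Γ, B)` is a biased graph: `B` is a linear class of circles of `Γ`, that is, no theta graph
contains exactly two circles of `B`. -/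
def IsBiasedGraph {N E : Type*} (Γ : HalfGraph N E) (B : Set (Set E)) : Prop :=
  (∀ C ∈ B, Γ.IsCircle C) ∧ ∀ T, Γ.IsTheta T → {C ∈ B | C ⊆ T}.encard ≠ 2

/-- Balance of an edge set in `(Γ, B)`: it has no half edges and all its circles are in `B`. -/
def IsBalanced {N E : Type*} (Γ : HalfGraph N E) (B : Set (Set E)) (S : Set E) : Prop :=
  (∀ e ∈ S, ¬ Γ.IsHalfEdge e) ∧ ∀ C, Γ.IsCircle C → C ⊆ S → C ∈ B

/-- An unbalanced figure of `(Γ, B)`: a half edge or an unbalanced circle. -/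
def IsUnbalancedFigure {N E : Type*} (Γ : HalfGraph N E) (B : Set (Set E)) (F : Set E) : Prop :=
  (∃ e, Γ.IsHalfEdge e ∧ F = {e}) ∨ (Γ.IsCircle F ∧ F ∉ B)

/-- A frame circuit of `(Γ, B)`: a balanced circle, a theta graph without balanced circles, two
unbalanced figures with exactly one common node, or two node-disjoint unbalanced figures with a path
that connects them and meets each of them only in one of its endpoints. -/
def IsFrameCircuit {N E : Type*} (Γ : HalfGraph N E) (B : Set (Set E)) (C : Set E) : Prop :=
  (Γ.IsCircle C ∧ C ∈ B) ∨
  (Γ.IsTheta C ∧ ∀ D ∈ B, ¬ D ⊆ C) ∨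
  (∃ F₁ F₂ v, Γ.IsUnbalancedFigure B F₁ ∧ Γ.IsUnbalancedFigure B F₂ ∧ Disjoint F₁ F₂ ∧
    Γ.nodes F₁ ∩ Γ.nodes F₂ = {v} ∧ C = F₁ ∪ F₂) ∨
  (∃ F₁ F₂ u w X S, Γ.IsUnbalancedFigure B F₁ ∧ Γ.IsUnbalancedFigure B F₂ ∧
    Disjoint (Γ.nodes F₁) (Γ.nodes F₂) ∧ Γ.IsPath u w X S ∧
    Γ.nodes F₁ ∩ X = {u} ∧ Γ.nodes F₂ ∩ X = {w} ∧ C = F₁ ∪ F₂ ∪ S)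

/-- `M` is the frame matroid `G(Γ, B)`: its elements are the edges and its circuits are exactly the
frame circuits. (A matroid is determined by its ground set and its circuits, so there is at most one
such `M`.) -/
def IsFrameMatroid {N E : Type*} (Γ : HalfGraph N E) (B : Set (Set E)) (M : Matroid E) : Prop :=
  M.E = Set.univ ∧ ∀ C, M.IsCircuit C ↔ Γ.IsFrameCircuit B C

end HalfGraph

/-! ### The biased graph of a point set on the edge lines -/

namespace ProjGeom

theorem mem_span_of_line {P : Type*} (G : ProjGeom P) {S : Set P} {p q x : P} {l : Set P}
    (hp : p ∈ G.span S) (hq : q ∈ G.span S) (hpq : p ≠ q) (hl : l ∈ G.lines) (hpl : p ∈ l)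
    (hql : q ∈ l) (hx : x ∈ l) : x ∈ G.span S :=
  G.isFlat_span S p hp q hq hpq l hl hpl hql hx

/-- Two edge lines through a point outside `Nhat` have the same ends. -/
theorem mem_pair_of_edge_lines {P : Type*} (G : ProjGeom P) {Nhat : Set P} (hN : G.Indep Nhat)
    {p v w v' w' : P} {l l' : Set P} (hp : p ∉ Nhat) (hv : v ∈ Nhat) (hw : w ∈ Nhat)
    (hv' : v' ∈ Nhat) (hw' : w' ∈ Nhat) (hvw : v ≠ w) (hvw' : v' ≠ w') (hl : l ∈ G.lines)
    (hl' : l' ∈ G.lines) (hvl : v ∈ l) (hwl : w ∈ l) (hpl : p ∈ l) (hvl' : v' ∈ l')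
    (hwl' : w' ∈ l') (hpl' : p ∈ l') : v' = v ∨ v' = w := by
  by_contra! hcon
  obtain ⟨h1, h2⟩ := hcon
  have hsub : ∀ {x}, x ∈ Nhat → x ≠ v' → x ∈ G.span (Nhat \ {v'}) :=
    fun hx hne => G.subset_span _ ⟨hx, hne⟩
  have hps : p ∈ G.span (Nhat \ {v'}) :=
    G.mem_span_of_line (hsub hv (Ne.symm h1)) (hsub hw (Ne.symm h2)) hvw hl hvl hwl hpl
  exact hN v' hv' (G.mem_span_of_line hps (hsub hw' (Ne.symm hvw'))
    (fun h => hp (h ▸ hw')) hl' hpl' hwl' hvl')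

/-- The underlying graph. The nodes are the points of `Nhat` and the edges are the points of `Ehat`
(as two different types); a point of `Ehat` in `Nhat` is a half edge at that node, and any other
point of `Ehat` is a link between the two nodes on whose edge line it lies. -/
def edgePointGraph {P : Type*} (G : ProjGeom P) {Nhat Ehat : Set P} (hN : G.Indep Nhat)
    (hE : Ehat ⊆ G.fullEdgePoints Nhat) : HalfGraph Nhat Ehat where
  ends e := {v | (e : P) = v ∨ ((e : P) ∉ Nhat ∧ ∃ w : Nhat, v ≠ w ∧
    ∃ l ∈ G.lines, (v : P) ∈ l ∧ (w : P) ∈ l ∧ (e : P) ∈ l)}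
  half_or_link := by
    rintro ⟨e, he⟩
    by_cases heN : e ∈ Nhat
    · refine Or.inl ⟨⟨e, heN⟩, ?_⟩
      ext v
      simp [heN, Subtype.ext_iff, eq_comm]
    · obtain h | ⟨v, hv, w, hw, hvw, l, hl, hvl, hwl, hel⟩ := hE he
      · exact absurd h heN
      refine Or.inr ⟨⟨v, hv⟩, ⟨w, hw⟩, fun h => hvw (congrArg Subtype.val h), ?_⟩
      ext ⟨x, hx⟩
      simp only [Set.mem_ofPred_eq, Set.mem_insert_iff, Set.mem_singleton_iff, Subtype.mk.injEq]
      constructor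
      · rintro (h | ⟨-, ⟨y, hy⟩, hxy, l', hl', hxl', hyl', hel'⟩)
        · exact absurd (h ▸ hx) heN
        · exact G.mem_pair_of_edge_lines hN heN hv hw hx hy hvw
            (fun h => hxy (Subtype.ext h)) hl hl' hvl hwl hel hxl' hyl' hel'
      · rintro (rfl | rfl)
        · exact Or.inr ⟨heN, ⟨w, hw⟩, fun h => hvw (congrArg Subtype.val h), l, hl, hvl, hwl, hel⟩
        · exact Or.inr ⟨heN, ⟨v, hv⟩, fun h => hvw (congrArg Subtype.val h).symm,
            l, hl, hwl, hvl, hel⟩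

/-- The balanced circles: those whose points lie in a cross-flat. -/
def balancedCircles {P : Type*} (G : ProjGeom P) {Nhat Ehat : Set P} (hN : G.Indep Nhat)
    (hE : Ehat ⊆ G.fullEdgePoints Nhat) : Set (Set Ehat) :=
  {C | (G.edgePointGraph hN hE).IsCircle C ∧
    ∃ t, G.IsCrossFlat Nhat t ∧ Subtype.val '' C ⊆ t}

end ProjGeom

/-! Two facts translate the geometry into graph theory. First, `mem_ends_iff`: since `Nhat` is
independent, the endpoints of an edge are the nodes `v` for which its point lies outside `span (Nhat
\ {v})`, that is, the support of the point in the basis `Nhat`. So a point with an endpoint `v` is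
never spanned by points whose edges avoid `v`; this gives all the independence statements. Second,
`IsFlat.nodes_mem_of_isPath`: a flat that contains the edge points of a path contains all of its
nodes or none, because two points of an edge line determine the line. Hence an unbalanced circle
spans all its nodes and is independent, while the points of a balanced circle are dependent.

For (a), a theta graph has a spanning tree whose span is a cross-flat; if two circles are balanced,
this cross-flat contains the whole theta graph, so the third is balanced. By the first fact a
circuit of the matroid on the edges is leafless: no node is on exactly one of its edges. Frame
circuits are dependent, and their leafless proper subsets, being few, turn out not to be circuits;
hence frame circuits are circuits. Conversely, a circuit is finite and leafless. If it contains no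
balanced circle, a path followed from an unbalanced figure in it must close up, and so produces a
frame circuit (`LeaflessOff.exists_frameCircuit`). Minimality makes the two equal.

For (b), closure in the matroid is the trace of the span, and what has to be shown is that a
balanced set spans no node. A minimal set of edges spanning a node `n` is independent and leafless
except at `n`, so it contains a half edge or a circle, and balance excludes both. -/

section Graph

namespace HalfGraph

/-! ### Links, half edges and node sets -/

variable {N E : Type*} {Γ : HalfGraph N E}

theorem IsLink.symm {e : E} {v w : N} (h : Γ.IsLink e v w) : Γ.IsLink e w v :=
  ⟨h.1.symm, by rw [h.2, Set.pair_comm]⟩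

theorem IsLink.left_mem {e : E} {v w : N} (h : Γ.IsLink e v w) : v ∈ Γ.ends e := by
  simp [h.2]

theorem IsLink.right_mem {e : E} {v w : N} (h : Γ.IsLink e v w) : w ∈ Γ.ends e := by
  simp [h.2]

theorem exists_isLink {e : E} {v : N} (he : ¬ Γ.IsHalfEdge e) (hv : v ∈ Γ.ends e) :
    ∃ w, Γ.IsLink e v w := by
  obtain h | ⟨a, b, hab, h⟩ := Γ.half_or_link e
  · exact absurd h he
  · rw [h] at hv
    obtain rfl | rfl := hv
    · exact ⟨b, hab, h⟩
    · exact ⟨a, IsLink.symm ⟨hab, h⟩⟩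

theorem exists_mem_ends (Γ : HalfGraph N E) (e : E) : ∃ v, v ∈ Γ.ends e := by
  obtain ⟨v, hv⟩ | ⟨v, _, _, hv⟩ := Γ.half_or_link e <;> exact ⟨v, by simp [hv]⟩

theorem mem_nodes {S : Set E} {e : E} {v : N} (he : e ∈ S) (hv : v ∈ Γ.ends e) : v ∈ Γ.nodes S :=
  Set.mem_biUnion he hv

theorem mem_nodes_iff {S : Set E} {v : N} : v ∈ Γ.nodes S ↔ ∃ e ∈ S, v ∈ Γ.ends e := by
  simp [nodes]

theorem nodes_union (S T : Set E) : Γ.nodes (S ∪ T) = Γ.nodes S ∪ Γ.nodes T := by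
  exact Set.biUnion_union ..

theorem nodes_insert (e : E) (S : Set E) : Γ.nodes (insert e S) = Γ.ends e ∪ Γ.nodes S := by
  simp [nodes]

theorem nodes_singleton (e : E) : Γ.nodes {e} = Γ.ends e := by
  simp [nodes]

/-! #### Paths -/

namespace IsPath

theorem left_mem {u w : N} {X : Set N} {S : Set E} (h : Γ.IsPath u w X S) : u ∈ X := by
  cases h <;> simp

theorem right_mem {u w : N} {X : Set N} {S : Set E} (h : Γ.IsPath u w X S) : w ∈ X := by
  induction h with
  | nil v => rfl
  | cons _ _ _ ih => exact Or.inr ih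

theorem finite {u w : N} {X : Set N} {S : Set E} (h : Γ.IsPath u w X S) : S.Finite := by
  induction h with
  | nil v => exact Set.finite_empty
  | cons _ _ _ ih => exact ih.insert _

theorem ends_subset {u w : N} {X : Set N} {S : Set E} (h : Γ.IsPath u w X S) {e : E}
    (he : e ∈ S) : Γ.ends e ⊆ X := by
  induction h with
  | nil v => exact absurd he (Set.notMem_empty _)
  | cons hl hp _ ih =>
    obtain rfl | he := he
    · rw [hl.2]
      exact Set.insert_subset (Or.inl rfl) (Set.singleton_subset_iff.2 (Or.inr hp.left_mem))
    · exact (ih he).trans (Set.subset_insert _ _)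

theorem nodes_subset {u w : N} {X : Set N} {S : Set E} (h : Γ.IsPath u w X S) :
    Γ.nodes S ⊆ X :=
  Set.iUnion₂_subset fun _ he => h.ends_subset he

theorem exists_isLink {u w : N} {X : Set N} {S : Set E} (h : Γ.IsPath u w X S) {e : E}
    (he : e ∈ S) : ∃ a b, Γ.IsLink e a b := by
  induction h with
  | nil v => exact absurd he (Set.notMem_empty _)
  | cons hl _ _ ih =>
    obtain rfl | he := he
    · exact ⟨_, _, hl⟩
    · exact ih he

theorem subset_insert_nodes {u w : N} {X : Set N} {S : Set E} (h : Γ.IsPath u w X S) :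
    X ⊆ insert w (Γ.nodes S) := by
  induction h with
  | nil v => simp
  | cons hl _ _ ih =>
    rw [nodes_insert]
    rintro x (rfl | hx)
    · exact Or.inr (Or.inl hl.left_mem)
    · exact (ih hx).imp id Or.inr

/-- A common edge would be a link, and its two distinct endpoints would both be common nodes. -/
theorem disjoint_of_nodes_inter {u w v : N} {X : Set N} {S T : Set E} (h : Γ.IsPath u w X S)
    (hT : Γ.nodes T ∩ X ⊆ {v}) : Disjoint S T := by
  rw [Set.disjoint_left]
  intro e he heT
  obtain ⟨a, b, hab⟩ := h.exists_isLink he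
  have ha := hT ⟨mem_nodes heT hab.left_mem, h.ends_subset he hab.left_mem⟩
  have hb := hT ⟨mem_nodes heT hab.right_mem, h.ends_subset he hab.right_mem⟩
  exact hab.1 (ha.trans hb.symm)

theorem append {u v w : N} {X Y : Set N} {S T : Set E} (h : Γ.IsPath u v X S)
    (h' : Γ.IsPath v w Y T) (hXY : X ∩ Y ⊆ {v}) : Γ.IsPath u w (X ∪ Y) (S ∪ T) := by
  induction h with
  | nil v =>
    rwa [Set.empty_union, Set.union_eq_self_of_subset_left
      (Set.singleton_subset_iff.2 h'.left_mem)]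
  | cons hl hp hu ih =>
    rw [Set.insert_union, Set.insert_union]
    refine .cons hl (ih h' fun x hx => hXY ⟨Or.inr hx.1, hx.2⟩) ?_
    rintro (h | h)
    · exact hu h
    · have := hXY ⟨Or.inl rfl, h⟩
      rw [Set.mem_singleton_iff] at this
      exact hu (this ▸ hp.right_mem)

theorem reverse {u w : N} {X : Set N} {S : Set E} (h : Γ.IsPath u w X S) :
    Γ.IsPath w u X S := by
  induction h with
  | nil v => exact .nil v
  | @cons u v w X S e hl hp hu ih =>
    have h1 := ih.append (.cons hl.symm (.nil u) (by simpa using hl.1.symm)) (by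
      rintro x ⟨hx, rfl | rfl⟩
      · rfl
      · exact absurd hx hu)
    convert h1 using 1
    · ext x
      have := hp.left_mem
      simp only [Set.mem_insert_iff, Set.mem_union, Set.mem_singleton_iff]
      grind
    · ext x
      simp

theorem eq_of_self {u : N} {X : Set N} {S : Set E} (h : Γ.IsPath u u X S) : S = ∅ := by
  cases h with
  | nil => rfl
  | cons _ hp hu => exact absurd hp.right_mem hu

theorem exists_cons {u w : N} {X : Set N} {S : Set E} (h : Γ.IsPath u w X S) (huw : u ≠ w) :
    ∃ v e Y T, Γ.IsLink e u v ∧ Γ.IsPath v w Y T ∧ u ∉ Y ∧ X = insert u Y ∧ S = insert e T ∧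
      e ∉ T := by
  cases h with
  | nil => exact absurd rfl huw
  | cons hl hp hu => exact ⟨_, _, _, _, hl, hp, hu, rfl, rfl,
      fun he => hu (hp.ends_subset he hl.left_mem)⟩

theorem nonempty {u w : N} {X : Set N} {S : Set E} (h : Γ.IsPath u w X S) (huw : u ≠ w) :
    S.Nonempty := by
  obtain ⟨_, e, _, _, _, _, _, _, rfl, _⟩ := h.exists_cons huw
  exact ⟨e, Or.inl rfl⟩

theorem split {u w x : N} {X : Set N} {S : Set E} (h : Γ.IsPath u w X S) (hx : x ∈ X) :
    ∃ X₁ S₁ X₂ S₂, Γ.IsPath u x X₁ S₁ ∧ Γ.IsPath x w X₂ S₂ ∧ X₁ ∩ X₂ = {x} ∧ X = X₁ ∪ X₂ ∧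
      S = S₁ ∪ S₂ := by
  induction h with
  | nil v =>
    obtain rfl := hx
    exact ⟨_, _, _, _, .nil _, .nil _, by simp, by simp, by simp⟩
  | @cons u v w X S e hl hp hu ih =>
    obtain rfl | hx := hx
    · refine ⟨_, _, _, _, .nil _, .cons hl hp hu, ?_, ?_, ?_⟩ <;> simp
    · obtain ⟨X₁, S₁, X₂, S₂, h1, h2, h3, rfl, rfl⟩ := ih hx
      refine ⟨_, _, _, _, .cons hl h1 fun h => hu (Or.inl h), h2, ?_, ?_, ?_⟩
      · rw [Set.insert_inter_of_notMem fun h => hu (Or.inr h), h3]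
      · rw [Set.insert_union]
      · rw [Set.insert_union]

theorem split_edge {u w : N} {X : Set N} {S : Set E} {e : E} (h : Γ.IsPath u w X S) (he : e ∈ S) :
    ∃ a b X₁ S₁ X₂ S₂, Γ.IsPath u a X₁ S₁ ∧ Γ.IsLink e a b ∧ Γ.IsPath b w X₂ S₂ ∧
      Disjoint X₁ X₂ ∧ X = X₁ ∪ X₂ ∧ S = insert e (S₁ ∪ S₂) ∧ e ∉ S₁ ∪ S₂ := by
  induction h with
  | nil v => exact absurd he (Set.notMem_empty _)
  | @cons u v w X S f hl hp hu ih =>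
    obtain rfl | he := he
    · refine ⟨_, _, _, _, _, _, .nil u, hl, hp, by simpa using hu, ?_, ?_, ?_⟩
      · rw [Set.singleton_union]
      · simp
      · rw [Set.empty_union]
        exact fun he => hu (hp.ends_subset he hl.left_mem)
    · have hf : f ∉ S := fun he => hu (hp.ends_subset he hl.left_mem)
      obtain ⟨a, b, X₁, S₁, X₂, S₂, h1, h2, h3, h4, rfl, rfl, h5⟩ := ih he
      refine ⟨_, _, _, _, _, _, .cons hl h1 fun h => hu (Or.inl h), h2, h3, ?_, ?_, ?_, ?_⟩
      · exact Set.disjoint_insert_left.2 ⟨fun h => hu (Or.inr h), h4⟩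
      · rw [Set.insert_union]
      · rw [Set.insert_union, Set.insert_comm]
      · rw [Set.insert_union]
        rintro (rfl | h)
        · exact hf he
        · exact h5 h

end IsPath

/-! #### Circles -/

theorem nodes_insert_eq {u w : N} {X : Set N} {S : Set E} {e : E} (h : Γ.IsPath u w X S)
    (he : Γ.IsLink e u w) : Γ.nodes (insert e S) = X := by
  rw [nodes_insert]
  refine (Set.union_subset ?_ h.nodes_subset).antisymm fun x hx => ?_
  · rw [he.2]
    exact Set.insert_subset h.left_mem (Set.singleton_subset_iff.2 h.right_mem)
  · obtain rfl | hx := h.subset_insert_nodes hx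
    · exact Or.inl he.right_mem
    · exact Or.inr hx

namespace IsCircle

theorem nonempty {C : Set E} (h : Γ.IsCircle C) : C.Nonempty := by
  obtain ⟨_, _, _, _, e, _, _, _, rfl⟩ := h
  exact ⟨e, Or.inl rfl⟩

theorem exists_path {C : Set E} (h : Γ.IsCircle C) {f : E} (hf : f ∈ C) :
    ∃ u w X S, Γ.IsPath u w X S ∧ Γ.IsLink f u w ∧ f ∉ S ∧ C = insert f S := by
  obtain ⟨u, w, X, S, e, hp, he, heS, rfl⟩ := h
  obtain rfl | hf := hf
  · exact ⟨u, w, X, S, hp, he, heS, rfl⟩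
  obtain ⟨a, b, X₁, S₁, X₂, S₂, h1, h2, h3, h4, rfl, rfl, h5⟩ := hp.split_edge hf
  rw [Set.disjoint_left] at h4
  have h6 := h3.append (.cons he.symm h1 fun h => h4 h h3.right_mem) (by
    rintro x ⟨hx, rfl | hx'⟩
    · rfl
    · exact absurd hx (h4 hx'))
  refine ⟨b, a, _, _, h6, h2.symm, ?_, ?_⟩
  · rintro (h | rfl | h)
    · exact h5 (Or.inr h)
    · exact heS hf
    · exact h5 (Or.inl h)
  · ext x
    simp only [Set.mem_insert_iff, Set.mem_union]
    tauto

theorem exists_path_from {C : Set E} (h : Γ.IsCircle C) {x : N} (hx : x ∈ Γ.nodes C) :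
    ∃ w X S f, Γ.IsPath x w X S ∧ Γ.IsLink f x w ∧ f ∉ S ∧ C = insert f S := by
  obtain ⟨f, hf, hxf⟩ := mem_nodes_iff.1 hx
  obtain ⟨u, w, X, S, hp, hl, hfS, rfl⟩ := h.exists_path hf
  rw [hl.2] at hxf
  obtain rfl | rfl := hxf
  · exact ⟨_, _, _, _, hp, hl, hfS, rfl⟩
  · exact ⟨_, _, _, _, hp.reverse, hl.symm, hfS, rfl⟩

theorem two_paths {C : Set E} (h : Γ.IsCircle C) {x y : N} (hx : x ∈ Γ.nodes C)
    (hy : y ∈ Γ.nodes C) (hxy : x ≠ y) :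
    ∃ X₁ S₁ X₂ S₂, Γ.IsPath x y X₁ S₁ ∧ Γ.IsPath x y X₂ S₂ ∧ X₁ ∩ X₂ = {x, y} ∧
      Disjoint S₁ S₂ ∧ C = S₁ ∪ S₂ ∧ Γ.nodes C = X₁ ∪ X₂ := by
  obtain ⟨w, X, S, f, hp, hl, hf, rfl⟩ := h.exists_path_from hx
  rw [nodes_insert_eq hp hl] at hy
  have hn := nodes_insert_eq hp hl
  obtain ⟨X₁, S₁, X₂, S₂, h1, h2, h3, rfl, rfl⟩ := hp.split hy
  have hx2 : x ∉ X₂ := fun h => hxy (h3.subset ⟨h1.left_mem, h⟩)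
  refine ⟨_, _, _, _, h1, .cons hl h2.reverse hx2, ?_, ?_, ?_, ?_⟩
  · rw [Set.inter_insert_of_mem h1.left_mem, h3]
  · refine Set.disjoint_insert_right.2 ⟨fun h => hf (Or.inl h), ?_⟩
    refine h1.disjoint_of_nodes_inter (v := y) fun z hz => ?_
    exact h3.subset ⟨hz.2, h2.nodes_subset hz.1⟩
  · rw [Set.union_insert]
  · rw [hn, Set.union_insert]
    exact (Set.insert_eq_of_mem (Set.mem_union_left X₂ h1.left_mem)).symm

end IsCircle

/-- The first link of one path closes the path formed by the rest. Disjointness of the edge sets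
matters only when both paths might be the same single link. -/
theorem isCircle_union {x y : N} {X₁ X₂ : Set N} {S₁ S₂ : Set E} (h₁ : Γ.IsPath x y X₁ S₁)
    (h₂ : Γ.IsPath x y X₂ S₂) (hxy : x ≠ y) (hX : X₁ ∩ X₂ = {x, y}) (hS : Disjoint S₁ S₂) :
    Γ.IsCircle (S₁ ∪ S₂) := by
  obtain ⟨v, e, Y, T, hl, hp, hx, rfl, rfl, he⟩ := h₁.exists_cons hxy
  have h := hp.append h₂.reverse (by
    rintro z ⟨hz, hz'⟩
    obtain rfl | h := hX.subset ⟨Or.inr hz, hz'⟩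
    · exact absurd hz hx
    · exact h)
  refine ⟨_, _, _, _, e, h, hl.symm, ?_, Set.insert_union ..⟩
  rintro (h | h)
  · exact he h
  · exact Set.disjoint_left.1 hS (Or.inl rfl) h

/-- Adding to a path a link from its first node to one of its nodes closes a circle. -/
theorem IsPath.exists_circle {z x z' : N} {X : Set N} {S : Set E} {f : E}
    (h : Γ.IsPath z x X S) (hz' : z' ∈ X) (hf : Γ.IsLink f z z') (hfS : f ∉ S) :
    ∃ C X₁ X₂ T, Γ.IsCircle C ∧ C ∪ T = insert f S ∧ Γ.nodes C = X₁ ∧ X₁ ∪ X₂ = X ∧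
      Γ.IsPath z' x X₂ T ∧ X₁ ∩ X₂ = {z'} ∧ Disjoint C T := by
  obtain ⟨X₁, S₁, X₂, S₂, h1, h2, h3, rfl, rfl⟩ := h.split hz'
  have hn := nodes_insert_eq h1 hf
  refine ⟨insert f S₁, X₁, X₂, S₂, ⟨_, _, _, _, f, h1, hf, fun h => hfS (Or.inl h), rfl⟩,
    Set.insert_union .., hn, rfl, h2, h3, ?_⟩
  refine (h2.disjoint_of_nodes_inter (v := z') ?_).symm
  rw [hn, h3]

/-! #### Leafless edge sets -/

/-- No node outside `Y` lies on exactly one edge of `K`. -/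
def LeaflessOff (Γ : HalfGraph N E) (Y : Set N) (K : Set E) : Prop :=
  ∀ v ∉ Y, ∀ e ∈ K, v ∈ Γ.ends e → ∃ f ∈ K, f ≠ e ∧ v ∈ Γ.ends f

theorem LeaflessOff.mono {Y Z : Set N} {K : Set E} (h : Γ.LeaflessOff Y K) (hYZ : Y ⊆ Z) :
    Γ.LeaflessOff Z K :=
  fun v hv => h v fun hvY => hv (hYZ hvY)

theorem IsCircle.leaflessOff {C : Set E} (h : Γ.IsCircle C) : Γ.LeaflessOff ∅ C := by
  intro v _ e he hv
  obtain ⟨w, X, S, f, hp, hl, hf, rfl⟩ := h.exists_path_from (mem_nodes he hv)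
  obtain ⟨_, g, _, _, hg, _, _, _, rfl, _⟩ := hp.exists_cons hl.1
  have hfg : f ≠ g := fun h => hf (Or.inl h)
  by_cases hef : e = f
  · exact ⟨g, Or.inr (Or.inl rfl), hef ▸ hfg.symm, hg.left_mem⟩
  · exact ⟨f, Or.inl rfl, Ne.symm hef, hl.left_mem⟩

/-- Peeling from the free end `u`: the first link of the path is the only edge of `I ∪ S` at `u`, so
a leafless set cannot use it, and the next node becomes the free end. -/
theorem LeaflessOff.subset_of_path_end {u w : N} {X : Set N} {S I K : Set E}
    (h : Γ.IsPath u w X S) (hK : Γ.LeaflessOff ∅ K) (hKI : K ⊆ I ∪ S)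
    (hI : Γ.nodes I ∩ X ⊆ {w}) : K ⊆ I := by
  induction h with
  | nil v => simpa using hKI
  | @cons u v w X S e hl hp hu ih =>
    have he : e ∉ K := by
      intro he
      obtain ⟨f, hf, hfe, huf⟩ := hK u (Set.notMem_empty _) e he hl.left_mem
      obtain hf | rfl | hf := hKI hf
      · have : u = w := hI ⟨mem_nodes hf huf, Or.inl rfl⟩
        exact hu (this ▸ hp.right_mem)
      · exact hfe rfl
      · exact hu (hp.ends_subset hf huf)
    refine ih (fun f hf => ?_) fun x hx => hI ⟨hx.1, Or.inr hx.2⟩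
    obtain h | rfl | h := hKI hf
    · exact Or.inl h
    · exact absurd hf he
    · exact Or.inr h

/-- A leafless subset of `I ∪ S` does not meet a path `S` that has at most one node in common
with `I`. -/
theorem LeaflessOff.subset_of_path {u w v : N} {X : Set N} {S I K : Set E}
    (hK : Γ.LeaflessOff ∅ K) (h : Γ.IsPath u w X S) (hKI : K ⊆ I ∪ S)
    (hI : Γ.nodes I ∩ X ⊆ {v}) : K ⊆ I := by
  by_cases hv : v ∈ X
  · obtain ⟨X₁, S₁, X₂, S₂, h1, h2, h3, rfl, rfl⟩ := h.split hv
    refine LeaflessOff.subset_of_path_end h1 hK ?_ fun x hx => hI ⟨hx.1, Or.inl hx.2⟩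
    refine LeaflessOff.subset_of_path_end h2.reverse hK (by rwa [Set.union_assoc]) ?_
    rw [nodes_union]
    rintro x ⟨hx | hx, hx2⟩
    · exact hI ⟨hx, Or.inr hx2⟩
    · exact h3.subset ⟨h1.nodes_subset hx, hx2⟩
  · refine LeaflessOff.subset_of_path_end h hK hKI fun x hx => ?_
    have : x = v := hI hx
    exact absurd (this ▸ hx.2) hv

theorem IsPath.eq_empty_of_leafless {u w : N} {X : Set N} {S K : Set E} (h : Γ.IsPath u w X S)
    (hK : Γ.LeaflessOff ∅ K) (hKS : K ⊆ S) : K = ∅ :=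
  Set.subset_empty_iff.1 (hK.subset_of_path h (v := u) (hKS.trans Set.subset_union_right)
    (by simp [nodes]))

/-- Without one of its edges a circle is a path, which has no nonempty leafless subset. -/
theorem IsCircle.eq_of_leafless {C K : Set E} (h : Γ.IsCircle C) (hK : Γ.LeaflessOff ∅ K)
    (hne : K.Nonempty) (hKC : K ⊆ C) : K = C := by
  refine hKC.antisymm fun f hf => by_contra fun hfK => ?_
  obtain ⟨u, w, X, S, hp, _, _, rfl⟩ := h.exists_path hf
  refine hne.ne_empty (hp.eq_empty_of_leafless hK fun e he => ?_)
  exact (hKC he).resolve_left fun h => hfK (h ▸ he)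

/-! #### Theta graphs -/

/-- An edge of `S₁` missing from `K` cuts that path into two tails, attached to the other two paths
only at `u` and only at `w`. Both tails peel off. -/
theorem LeaflessOff.subset_of_theta {u w : N} {X₁ X₂ X₃ : Set N} {S₁ S₂ S₃ K : Set E}
    (hK : Γ.LeaflessOff ∅ K) (h₁ : Γ.IsPath u w X₁ S₁) (h₂ : Γ.IsPath u w X₂ S₂)
    (h₃ : Γ.IsPath u w X₃ S₃) (h₁₂ : X₁ ∩ X₂ = {u, w}) (h₁₃ : X₁ ∩ X₃ = {u, w})
    (hKS : K ⊆ S₁ ∪ (S₂ ∪ S₃)) (hS : ¬ S₁ ⊆ K) : K ⊆ S₂ ∪ S₃ := by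
  obtain ⟨e, he, heK⟩ := Set.not_subset.1 hS
  obtain ⟨a, b, Y, T, Z, U, hY, _, hZ, hYZ, rfl, rfl, _⟩ := h₁.split_edge he
  rw [Set.disjoint_left] at hYZ
  have key : ∀ x ∈ Γ.nodes (S₂ ∪ S₃), x ∈ Y ∪ Z → x = u ∨ x = w := by
    rw [nodes_union]
    rintro x (hx | hx) hxY
    · exact h₁₂.subset ⟨hxY, h₂.nodes_subset hx⟩
    · exact h₁₃.subset ⟨hxY, h₃.nodes_subset hx⟩
  refine hK.subset_of_path hY (v := u) (hK.subset_of_path hZ (v := w) ?_ ?_) ?_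
  · intro f hf
    have : f ≠ e := fun h => heK (h ▸ hf)
    have := hKS hf
    simp only [Set.mem_union, Set.mem_insert_iff] at this ⊢
    tauto
  · rw [nodes_union]
    rintro x ⟨hx | hx, hxZ⟩
    · obtain rfl | rfl := key x hx (Or.inr hxZ)
      · exact absurd hxZ (hYZ hY.left_mem)
      · rfl
    · exact absurd hxZ (hYZ (hY.nodes_subset hx))
  · rintro x ⟨hx, hxY⟩
    obtain rfl | rfl := key x hx (Or.inl hxY)
    · rfl
    · exact absurd hZ.right_mem (hYZ hxY)

/-- A leafless subset of a theta graph is one of its three circles or the whole theta graph. -/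
theorem LeaflessOff.eq_of_subset_theta {u w : N} {X₁ X₂ X₃ : Set N}
    {S₁ S₂ S₃ : Set E} (huw : u ≠ w)
    (h₁ : Γ.IsPath u w X₁ S₁) (h₂ : Γ.IsPath u w X₂ S₂) (h₃ : Γ.IsPath u w X₃ S₃)
    (h₁₂ : X₁ ∩ X₂ = {u, w}) (h₁₃ : X₁ ∩ X₃ = {u, w}) (h₂₃ : X₂ ∩ X₃ = {u, w})
    (hS₁₂ : Disjoint S₁ S₂) (hS₁₃ : Disjoint S₁ S₃) (hS₂₃ : Disjoint S₂ S₃) {K : Set E}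
    (hK : Γ.LeaflessOff ∅ K) (hne : K.Nonempty) (hKT : K ⊆ S₁ ∪ S₂ ∪ S₃) :
    K = S₁ ∪ S₂ ∨ K = S₁ ∪ S₃ ∨ K = S₂ ∪ S₃ ∨ K = S₁ ∪ S₂ ∪ S₃ := by
  by_cases hs1 : S₁ ⊆ K
  · by_cases hs2 : S₂ ⊆ K
    · by_cases hs3 : S₃ ⊆ K
      · exact Or.inr (Or.inr (Or.inr
          (hKT.antisymm (Set.union_subset (Set.union_subset hs1 hs2) hs3))))
      · refine Or.inl ((isCircle_union h₁ h₂ huw h₁₂ hS₁₂).eq_of_leafless hK hne ?_)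
        refine hK.subset_of_theta h₃ h₁ h₂ (by rwa [Set.inter_comm]) (by rwa [Set.inter_comm])
          (hKT.trans (Set.union_comm _ _).subset) hs3
    · refine Or.inr (Or.inl ((isCircle_union h₁ h₃ huw h₁₃ hS₁₃).eq_of_leafless hK hne ?_))
      refine hK.subset_of_theta h₂ h₁ h₃ (by rwa [Set.inter_comm]) h₂₃
        (hKT.trans (by rw [← Set.union_assoc, Set.union_comm S₂])) hs2
  · refine Or.inr (Or.inr (Or.inl
      ((isCircle_union h₂ h₃ huw h₂₃ hS₂₃).eq_of_leafless hK hne ?_)))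
    exact hK.subset_of_theta h₁ h₂ h₃ h₁₂ h₁₃ (hKT.trans (Set.union_assoc _ _ _).subset) hs1

/-! #### Extending a path until it closes up -/

/-- In a finite edge set without leaves off `Y`, follow edges from `x ∈ Y` until one meets a half
edge, the path, or `Y`. -/
theorem LeaflessOff.exists_closing_edge {Y : Set N} {K F : Set E} {x : N} (hK : Γ.LeaflessOff Y K)
    (hfin : K.Finite) (hF : Γ.nodes F ⊆ Y) {z : N} {X : Set N} {S : Set E} {f : E}
    (hp : Γ.IsPath z x X S) (hS : S ⊆ K) (hX : X ∩ Y = {x}) (hf : f ∈ K) (hfS : f ∉ S)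
    (hfF : f ∉ F) (hz : z ∈ Γ.ends f) :
    ∃ z X S f, Γ.IsPath z x X S ∧ S ⊆ K ∧ X ∩ Y = {x} ∧ f ∈ K ∧ f ∉ S ∧ f ∉ F ∧
      ((Γ.IsHalfEdge f ∧ z ∈ Γ.ends f) ∨ ∃ z', Γ.IsLink f z z' ∧ (z' ∈ X ∨ z' ∈ Y)) := by
  -- The path uses up edges of the finite set `K`, so the number of unused edges decreases.
  induction hn : (K \ S).ncard using Nat.strong_induction_on generalizing z X S f with
  | _ n ih =>
    by_cases hh : Γ.IsHalfEdge f
    · exact ⟨z, X, S, f, hp, hS, hX, hf, hfS, hfF, Or.inl ⟨hh, hz⟩⟩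
    obtain ⟨z', hl⟩ := exists_isLink hh hz
    by_cases hzX : z' ∈ X ∨ z' ∈ Y
    · exact ⟨z, X, S, f, hp, hS, hX, hf, hfS, hfF, Or.inr ⟨z', hl, hzX⟩⟩
    push Not at hzX
    obtain ⟨g, hg, hgf, hzg⟩ := hK z' hzX.2 f hf hl.right_mem
    refine ih _ ?_ (.cons hl.symm hp hzX.1) (Set.insert_subset hf hS) ?_ hg ?_ ?_ hzg rfl
    · rw [← hn]
      exact Set.ncard_lt_ncard ⟨fun e he => ⟨he.1, fun h => he.2 (Or.inr h)⟩,
        fun h => (h ⟨hf, hfS⟩).2 (Or.inl rfl)⟩ (hfin.subset Set.sdiff_subset)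
    · rw [Set.insert_inter_of_notMem hzX.2, hX]
    · rintro (h | h)
      · exact hgf h
      · exact hzX.1 (hp.ends_subset h hzg)
    · exact fun h => hzX.2 (hF (mem_nodes h hzg))

/-- A path followed from `x` stops at a half edge or closes a circle: reaching `Y = {x}` is also a
return to the path. -/
theorem LeaflessOff.exists_figure {K : Set E} {x : N} (hK : Γ.LeaflessOff {x} K) (hfin : K.Finite)
    {f : E} (hf : f ∈ K) (hx : x ∈ Γ.ends f) :
    (∃ e ∈ K, Γ.IsHalfEdge e) ∨ ∃ C ⊆ K, Γ.IsCircle C := by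
  obtain ⟨z, X, S, f, hp, hS, hX, hf, hfS, -, ⟨hh, -⟩ | ⟨z', hl, hz'⟩⟩ :=
    hK.exists_closing_edge hfin (F := ∅) (by simp [nodes]) (.nil x) (Set.empty_subset _) (by
        simp) hf
      (Set.notMem_empty _) (Set.notMem_empty _) hx
  · exact Or.inl ⟨f, hf, hh⟩
  · have hz : z' ∈ X := by
      obtain h | rfl := hz'
      · exact h
      · exact hp.right_mem
    obtain ⟨C, _, _, T, hC, hCT, -⟩ := hp.exists_circle hz hl hfS
    exact Or.inr ⟨C, (Set.subset_union_left.trans hCT.subset).trans (Set.insert_subset hf hS), hC⟩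

/-- A path leaving `F` at `x` can close up in three ways. A half edge or a return to the path itself
gives a second unbalanced figure, joined to `F` at `x` or by a path; a return to another node of `F`
gives a theta graph. -/
theorem LeaflessOff.exists_frameCircuit {B : Set (Set E)} {K F : Set E}
    (hK : Γ.LeaflessOff ∅ K) (hfin : K.Finite) (hB : ∀ D ∈ B, ¬ D ⊆ K)
    (hF : Γ.IsUnbalancedFigure B F) (hFK : F ⊆ K) {f : E} (hf : f ∈ K) (hfF : f ∉ F) {x : N}
    (hxf : x ∈ Γ.ends f) (hx : x ∈ Γ.nodes F) : ∃ C ⊆ K, Γ.IsFrameCircuit B C := by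
  obtain ⟨z, X, S, f, hp, hS, hX, hf, hfS, hfF, hcase⟩ :=
    (hK.mono (Set.empty_subset (Γ.nodes F))).exists_closing_edge hfin le_rfl (.nil x)
        (Set.empty_subset _)
      (Set.inter_eq_left.2 (Set.singleton_subset_iff.2 hx)) hf (Set.notMem_empty _) hfF hxf
  have hXF : ∀ {y}, y ∈ X → y ∈ Γ.nodes F → y = x := fun h h' => hX.subset ⟨h, h'⟩
  have hFX : Γ.nodes F ∩ X = {x} := by rw [Set.inter_comm, hX]
  have hSF : Disjoint S F := hp.disjoint_of_nodes_inter hFX.subset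
  have hcirc : ∀ {D}, Γ.IsCircle D → D ⊆ K → Γ.IsUnbalancedFigure B D :=
    fun h h' => Or.inr ⟨h, fun hD => hB _ hD h'⟩
  obtain ⟨hh, hz⟩ | ⟨z', hl, hz'⟩ := hcase
  · have hends : Γ.nodes {f} = {z} := by
      rw [nodes_singleton]
      obtain ⟨v, hv⟩ := hh
      rw [hv] at hz ⊢
      rw [Set.mem_singleton_iff.1 hz]
    have hfig : Γ.IsUnbalancedFigure B {f} := Or.inl ⟨f, hh, rfl⟩
    by_cases hzx : z = x
    · subst hzx
      refine ⟨{f} ∪ F, Set.union_subset (Set.singleton_subset_iff.2 hf) hFK,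
        Or.inr (Or.inr (Or.inl ⟨{f}, F, z, hfig, hF, by simpa using hfF, ?_, rfl⟩))⟩
      rw [hends]
      exact Set.inter_eq_left.2 (Set.singleton_subset_iff.2 hx)
    · refine ⟨{f} ∪ F ∪ S, Set.union_subset (Set.union_subset (Set.singleton_subset_iff.2 hf) hFK)
        hS, Or.inr (Or.inr (Or.inr ⟨{f}, F, z, x, X, S, hfig, hF, ?_, hp, ?_, hFX, rfl⟩))⟩
      · rw [hends, Set.disjoint_singleton_left]
        exact fun h => hzx (hXF hp.left_mem h)
      · rw [hends]
        exact Set.inter_eq_left.2 (Set.singleton_subset_iff.2 hp.left_mem)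
  by_cases hzX : z' ∈ X
  · obtain ⟨C, X₁, X₂, T, hC, hCT, hn, rfl, hT, h12, hdisj⟩ := hp.exists_circle hzX hl hfS
    have hCTK : C ∪ T ⊆ K := hCT.subset.trans (Set.insert_subset hf hS)
    have hCK : C ⊆ K := Set.subset_union_left.trans hCTK
    have hCF : Disjoint C F := by
      refine Set.disjoint_of_subset_left (Set.subset_union_left.trans hCT.subset) ?_
      exact Set.disjoint_insert_left.2 ⟨hfF, hSF⟩
    by_cases hzx : z' = x
    · subst hzx
      refine ⟨C ∪ F, Set.union_subset hCK hFK, Or.inr (Or.inr (Or.inl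
        ⟨C, F, z', hcirc hC hCK, hF, hCF, ?_, rfl⟩))⟩
      rw [hn]
      refine Set.Subset.antisymm (fun y hy => hXF (Or.inl hy.1) hy.2) ?_
      exact Set.singleton_subset_iff.2 ⟨(h12.superset rfl).1, hx⟩
    · have hxX₁ : x ∉ X₁ := fun h => hzx (h12.subset ⟨h, hT.right_mem⟩).symm
      refine ⟨C ∪ F ∪ T, Set.union_subset (Set.union_subset hCK hFK)
        (Set.subset_union_right.trans hCTK), Or.inr (Or.inr (Or.inr
        ⟨C, F, z', x, X₂, T, hcirc hC hCK, hF, ?_, hT, ?_, ?_, rfl⟩))⟩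
      · rw [hn, Set.disjoint_left]
        exact fun y hy hy' => hxX₁ (hXF (Or.inl hy) hy' ▸ hy)
      · rw [hn, h12]
      · refine Set.Subset.antisymm (fun y hy => hXF (Or.inr hy.2) hy.1) ?_
        exact Set.singleton_subset_iff.2 ⟨hx, hT.right_mem⟩
  -- The path returns to `F` at a node other than `x`. A half edge has only one node, so `F` is a
  -- circle, and `x` and `z'` split it into two paths of a theta graph.
  · have hzF := hz'.resolve_left hzX
    have hxz : x ≠ z' := fun h => hzX (h ▸ hp.right_mem)
    have hFC : Γ.IsCircle F := by
      obtain ⟨e, ⟨v, hv⟩, rfl⟩ | h := hF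
      · rw [nodes_singleton, hv] at hx hzF
        exact absurd (hx.trans hzF.symm) hxz
      · exact h.1
    obtain ⟨X₁, S₁, X₂, S₂, h1, h2, h12, hS12, rfl, hn⟩ := hFC.two_paths hx hzF hxz
    have h3 : Γ.IsPath x z' (insert z' X) (insert f S) :=
      (IsPath.cons hl.symm hp hzX).reverse
    have hTK : S₁ ∪ S₂ ∪ insert f S ⊆ K := Set.union_subset hFK (Set.insert_subset hf hS)
    rw [hn] at hXF
    refine ⟨_, hTK, Or.inr (Or.inl ⟨⟨x, z', X₁, X₂, insert z' X, S₁, S₂, insert f S, hxz, h1, h2,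
      h3, h12, ?_, ?_, hS12, ?_, ?_, rfl⟩, fun D hD hDT => hB D hD (hDT.trans hTK)⟩)⟩
    · refine Set.Subset.antisymm ?_ (Set.insert_subset ⟨h1.left_mem, h3.left_mem⟩
        (Set.singleton_subset_iff.2 ⟨h1.right_mem, h3.right_mem⟩))
      rintro y ⟨hy, rfl | hy'⟩
      · exact Or.inr rfl
      · exact Or.inl (hXF hy' (Or.inl hy))
    · refine Set.Subset.antisymm ?_ (Set.insert_subset ⟨h2.left_mem, h3.left_mem⟩
        (Set.singleton_subset_iff.2 ⟨h2.right_mem, h3.right_mem⟩))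
      rintro y ⟨hy, rfl | hy'⟩
      · exact Or.inr rfl
      · exact Or.inl (hXF hy' (Or.inr hy))
    · exact Set.disjoint_insert_right.2 ⟨fun h => hfF (Or.inl h),
        (Set.disjoint_union_right.1 hSF).1.symm⟩
    · exact Set.disjoint_insert_right.2 ⟨fun h => hfF (Or.inr h),
        (Set.disjoint_union_right.1 hSF).2.symm⟩

end HalfGraph

end Graph

namespace ProjGeom

open HalfGraph

/-! ### Span and independence -/

section Span

variable {P : Type*} {G : ProjGeom P}

theorem span_le_span {S T : Set P} (h : S ⊆ G.span T) : G.span S ⊆ G.span T :=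
  G.span_subset (G.isFlat_span T) h

theorem Indep.notMem_span {S : Set P} {x : P} (h : G.Indep (insert x S)) (hx : x ∉ S) :
    x ∉ G.span S := by
  have := h x (Set.mem_insert _ _)
  rwa [Set.insert_sdiff_of_mem _ (Set.mem_singleton x), Set.sdiff_singleton_eq_self hx] at this

theorem indep_empty : G.Indep ∅ := fun p hp => absurd hp (Set.notMem_empty p)

theorem not_indep_of_mem_span {A : Type*} {f : A → P} (hf : f.Injective) {T C : Set A} {e : A}
    (he : f e ∈ G.span (f '' T)) (heT : e ∉ T) (hC : insert e T ⊆ C) : ¬ G.Indep (f '' C) := by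
  intro h
  have h' := h.subset (Set.image_mono hC)
  rw [Set.image_insert_eq] at h'
  exact h'.notMem_span (fun h => heT ((hf.mem_set_image).1 h)) he

end Span

variable {P : Type*} {G : ProjGeom P} {Nhat Ehat : Set P} {hN : G.Indep Nhat}
  {hE : Ehat ⊆ G.fullEdgePoints Nhat}

local notation "Γ₀" => edgePointGraph G hN hE
local notation "B₀" => balancedCircles G hN hE

/-! #### Nodes and edges as points -/

/-- `span (Nhat \ {v})` plays the role of the coordinate hyperplane of `v`. An edge line at `v`
meets it in its other node only, since a second point would put `v` into it. -/
theorem mem_ends_iff {e : Ehat} {v : Nhat} :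
    v ∈ (Γ₀).ends e ↔ (e : P) ∉ G.span (Nhat \ {(v : P)}) := by
  constructor
  · rintro (h | ⟨he, w, hvw, l, hl, hvl, hwl, hel⟩) hs
    · rw [h] at hs
      exact hN v v.2 hs
    · refine hN v v.2 (G.mem_span_of_line hs (G.subset_span _ ⟨w.2, fun h => ?_⟩)
        (fun h => he (h ▸ w.2)) hl hel hwl hvl)
      exact hvw (Subtype.ext h).symm
  · contrapose!
    intro hv
    have hmem : ∀ {x}, x ∈ Nhat → x ≠ v → x ∈ G.span (Nhat \ {(v : P)}) :=
      fun hx hne => G.subset_span _ ⟨hx, hne⟩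
    by_cases heN : (e : P) ∈ Nhat
    · exact hmem heN fun h => hv (Or.inl h)
    obtain h | ⟨a, ha, b, hb, hab, l, hl, hal, hbl, hel⟩ := hE e.2
    · exact absurd h heN
    refine G.mem_span_of_line (hmem ha ?_) (hmem hb ?_) hab hl hal hbl hel
    · rintro rfl
      exact hv (Or.inr ⟨heN, ⟨b, hb⟩, fun h => hab (congrArg Subtype.val h), l, hl, hal, hbl, hel⟩)
    · rintro rfl
      exact hv (Or.inr ⟨heN, ⟨a, ha⟩, fun h => hab (congrArg Subtype.val h).symm, l, hl, hbl, hal,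
        hel⟩)

theorem image_subset_span_sdiff {T : Set Ehat} {v : Nhat} (hv : v ∉ (Γ₀).nodes T) :
    Subtype.val '' T ⊆ G.span (Nhat \ {(v : P)}) := by
  rintro _ ⟨e, he, rfl⟩
  by_contra h
  exact hv (mem_nodes he (mem_ends_iff.2 h))

theorem notMem_of_isLink {e : Ehat} {v w : Nhat} (h : (Γ₀).IsLink e v w) : (e : P) ∉ Nhat := by
  intro he
  have key : ∀ x : Nhat, x ∈ (Γ₀).ends e → (e : P) = x := by
    rintro x (h | h)
    · exact h
    · exact absurd he h.1
  exact h.1 (Subtype.ext ((key v h.left_mem).symm.trans (key w h.right_mem)))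

theorem exists_edge_line {e : Ehat} {v w : Nhat} (h : (Γ₀).IsLink e v w) :
    ∃ l ∈ G.lines, (v : P) ∈ l ∧ (w : P) ∈ l ∧ (e : P) ∈ l := by
  have heN := notMem_of_isLink h
  obtain h1 | ⟨-, x, hvx, l, hl, hvl, hxl, hel⟩ := h.left_mem
  · exact absurd (h1 ▸ v.2) heN
  have hx : x ∈ (Γ₀).ends e := Or.inr ⟨heN, v, hvx.symm, l, hl, hxl, hvl, hel⟩
  rw [h.2] at hx
  obtain rfl | rfl := hx
  · exact absurd rfl hvx
  · exact ⟨l, hl, hvl, hxl, hel⟩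

theorem IsFlat.mem_of_isLink {t : Set P} (ht : G.IsFlat t) {e : Ehat} {v w : Nhat}
    (h : (Γ₀).IsLink e v w) (hv : (v : P) ∈ t) (hw : (w : P) ∈ t) : (e : P) ∈ t := by
  obtain ⟨l, hl, hvl, hwl, hel⟩ := exists_edge_line h
  exact ht v hv w hw (fun hvw => h.1 (Subtype.ext hvw)) l hl hvl hwl hel

theorem IsFlat.node_mem_of_isLink {t : Set P} (ht : G.IsFlat t) {e : Ehat} {v w : Nhat}
    (h : (Γ₀).IsLink e v w) (hv : (v : P) ∈ t) (he : (e : P) ∈ t) : (w : P) ∈ t := by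
  obtain ⟨l, hl, hvl, hwl, hel⟩ := exists_edge_line h
  exact ht v hv e he (fun hve => notMem_of_isLink h (hve ▸ v.2)) l hl hvl hel hwl

theorem isHalfEdge_iff {e : Ehat} : (Γ₀).IsHalfEdge e ↔ (e : P) ∈ Nhat := by
  constructor
  · rintro ⟨v, hv⟩
    have hmem : v ∈ (Γ₀).ends e := by rw [hv]; rfl
    obtain h | ⟨heN, w, hvw, l, hl, hvl, hwl, hel⟩ := hmem
    · exact h ▸ v.2
    · have hw : w ∈ (Γ₀).ends e := Or.inr ⟨heN, v, hvw.symm, l, hl, hwl, hvl, hel⟩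
      rw [hv] at hw
      exact absurd hw.symm hvw
  · intro he
    obtain h | ⟨v, w, h⟩ := (Γ₀).half_or_link e
    · exact h
    · exact absurd he (notMem_of_isLink h)

theorem eq_of_isHalfEdge {e : Ehat} {v : Nhat} (h : (Γ₀).IsHalfEdge e) (hv : v ∈ (Γ₀).ends e) :
    (e : P) = v := by
  obtain h1 | h1 := hv
  · exact h1
  · exact absurd (isHalfEdge_iff.1 h) h1.1

/-! #### Paths -/

/-- An edge point and one end of its edge line determine the line, so membership of nodes spreads
along the path in both directions. -/
theorem IsFlat.nodes_mem_of_isPath {t : Set P} (ht : G.IsFlat t) {u w : Nhat} {X : Set Nhat}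
    {S : Set Ehat} (h : (Γ₀).IsPath u w X S) (hS : Subtype.val '' S ⊆ t)
    (hX : ∃ y ∈ X, (y : P) ∈ t) : ∀ x ∈ X, (x : P) ∈ t := by
  induction h with
  | nil v =>
    rintro x rfl
    obtain ⟨y, rfl, hy⟩ := hX
    exact hy
  | @cons u v w X S e hl hp hu ih =>
    rw [Set.image_insert_eq, Set.insert_subset_iff] at hS
    obtain ⟨y, rfl | hy, hyt⟩ := hX
    · rintro x (rfl | hx)
      · exact hyt
      · exact ih hS.2 ⟨v, hp.left_mem, ht.node_mem_of_isLink hl hyt hS.1⟩ x hx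
    · have := ih hS.2 ⟨y, hy, hyt⟩
      rintro x (rfl | hx)
      · exact ht.node_mem_of_isLink hl.symm (this v hp.left_mem) hS.1
      · exact this x hx

/-- The links are added starting from `w`. Each new link has an endpoint whose hyperplane contains
everything added before, but not the new point. -/
theorem indep_union_path {u w : Nhat} {X : Set Nhat} {S : Set Ehat} (h : (Γ₀).IsPath u w X S)
    {I : Set P} (hI : G.Indep I) (hIX : ∀ x ∈ X, x ≠ w → I ⊆ G.span (Nhat \ {(x : P)})) :
    G.Indep (I ∪ Subtype.val '' S) := by
  induction h with
  | nil v => simpa using hI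
  | @cons u v w X S e hl hp hu ih =>
    rw [Set.image_insert_eq, Set.union_insert]
    refine indep_insert (ih fun x hx => hIX x (Or.inr hx)) fun he => ?_
    refine mem_ends_iff.1 hl.left_mem (span_le_span (Set.union_subset ?_ ?_) he)
    · exact hIX u (Or.inl rfl) fun h => hu (h ▸ hp.right_mem)
    · exact image_subset_span_sdiff fun h => hu (hp.nodes_subset h)

/-- The node `w` can itself be added to `I` before the path, because `indep_union_path` requires
nothing at `w`. -/
theorem notMem_span_union_path {u w : Nhat} {X : Set Nhat} {S : Set Ehat}
    (h : (Γ₀).IsPath u w X S) {I : Set P} (hI : G.Indep I)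
    (hIX : ∀ x ∈ X, I ⊆ G.span (Nhat \ {(x : P)})) :
    (w : P) ∉ G.span (I ∪ Subtype.val '' S) := by
  have hw := hIX w h.right_mem
  have hwI : (w : P) ∉ G.span I := fun h => hN w w.2 (span_le_span hw h)
  have h1 := indep_union_path h (indep_insert hI hwI) fun x hx hxw => by
    refine Set.insert_subset (G.subset_span _ ⟨w.2, fun h => hxw ?_⟩) (hIX x hx)
    exact (Subtype.ext h).symm
  rw [Set.insert_union] at h1
  refine h1.notMem_span ?_
  rintro (hw | ⟨e, he, hew⟩)
  · exact hwI (G.subset_span _ hw)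
  · obtain ⟨_, _, hl⟩ := h.exists_isLink he
    exact notMem_of_isLink hl (hew ▸ w.2)

/-- If the points of a circle lie in a cross-flat, each is spanned by the others. -/
theorem mem_span_path_of_isCrossFlat {u w : Nhat} {X : Set Nhat} {S : Set Ehat} {e : Ehat}
    (h : (Γ₀).IsPath u w X S) (he : (Γ₀).IsLink e u w) {t : Set P} (ht : G.IsCrossFlat Nhat t)
    (hS : Subtype.val '' (insert e S) ⊆ t) : (e : P) ∈ G.span (Subtype.val '' S) := by
  by_contra hcon
  have hw : (w : P) ∈ G.span (insert (w : P) (Subtype.val '' S)) := G.subset_span _ (Or.inl rfl)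
  have hX := (G.isFlat_span _).nodes_mem_of_isPath h
    ((Set.subset_insert (w : P) _).trans (G.subset_span _)) ⟨w, h.right_mem, hw⟩
  -- The path and `w` span all nodes of the circle, hence `e`. If the path alone did not span `e`,
  -- exchange would put `w` into the span of the circle, and so into the cross-flat.
  have h1 := G.exchange ((G.isFlat_span _).mem_of_isLink he (hX u h.left_mem) hw) hcon
  rw [← Set.image_insert_eq] at h1
  exact Set.disjoint_left.1 ht.2 (G.span_subset ht.1 hS h1) w.2

/-! #### Unbalanced figures -/

/-- This is how imbalance is used. If `t` contained no node of the circle, neither would the span of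
the circle; nodes off the circle are excluded by their hyperplanes, so this span would be a
cross-flat. -/
theorem mem_of_isUnbalancedFigure {F : Set Ehat} (hF : (Γ₀).IsUnbalancedFigure B₀ F) {t : Set P}
    (ht : G.IsFlat t) (hFt : Subtype.val '' F ⊆ t) {x : Nhat} (hx : x ∈ (Γ₀).nodes F) :
    (x : P) ∈ t := by
  obtain ⟨e, he, rfl⟩ | ⟨hC, hB⟩ := hF
  · rw [nodes_singleton] at hx
    rw [← eq_of_isHalfEdge he hx]
    exact hFt ⟨e, rfl, rfl⟩
  · obtain ⟨u, w, X, S, e, hp, he, heS, rfl⟩ := id hC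
    rw [nodes_insert_eq hp he] at hx
    have h1 : ∃ y ∈ X, (y : P) ∈ t := by
      by_contra! hcon
      refine hB ⟨hC, G.span (Subtype.val '' insert e S), ⟨G.isFlat_span _, ?_⟩, G.subset_span _⟩
      rw [Set.disjoint_left]
      intro y hy hyN
      by_cases hyX : (⟨y, hyN⟩ : Nhat) ∈ X
      · exact hcon _ hyX (G.span_subset ht hFt hy)
      · refine hN y hyN (span_le_span (image_subset_span_sdiff (hN := hN) (hE := hE)
          (v := ⟨y, hyN⟩) ?_) hy)
        rwa [nodes_insert_eq hp he]
    exact ht.nodes_mem_of_isPath hp ((Set.image_mono (Set.subset_insert _ _)).trans hFt) h1 x hx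

/-- If the closing link of a circle were spanned by `I` and the path, the whole circle would be, and
with it the node `w`, contrary to `notMem_span_union_path`. -/
theorem indep_union_figure {F : Set Ehat} (hF : (Γ₀).IsUnbalancedFigure B₀ F) {I : Set P}
    (hI : G.Indep I) (hIF : ∀ x ∈ (Γ₀).nodes F, I ⊆ G.span (Nhat \ {(x : P)})) :
    G.Indep (I ∪ Subtype.val '' F) := by
  have hmem : ∀ x ∈ (Γ₀).nodes F, (x : P) ∈ G.span (Subtype.val '' F) :=
    fun x hx => mem_of_isUnbalancedFigure hF (G.isFlat_span _) (G.subset_span _) hx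
  obtain ⟨e, ⟨v, hv⟩, rfl⟩ | ⟨⟨u, w, X, S, e, hp, he, heS, rfl⟩, hB⟩ := hF
  · rw [Set.image_singleton, Set.union_singleton]
    have hve : v ∈ (Γ₀).ends e := by rw [hv]; rfl
    refine indep_insert hI fun h => mem_ends_iff.1 hve (span_le_span (hIF v ?_) h)
    rwa [nodes_singleton]
  · rw [nodes_insert_eq hp he] at hIF hmem
    rw [Set.image_insert_eq, Set.union_insert]
    refine indep_insert (indep_union_path hp hI fun x hx _ => hIF x hx) fun h => ?_
    refine notMem_span_union_path hp hI hIF (span_le_span ?_ (hmem w hp.right_mem))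
    rw [Set.image_insert_eq]
    exact Set.insert_subset h (Set.subset_union_right.trans (G.subset_span _))

theorem indep_figure {F : Set Ehat} (hF : (Γ₀).IsUnbalancedFigure B₀ F) :
    G.Indep (Subtype.val '' F) := by
  simpa using indep_union_figure hF indep_empty fun _ _ => Set.empty_subset _

/-- A half edge at `x` is the point `x` itself. In a circle, `x` and the path span every node, hence
also the closing link. -/
theorem not_indep_union_figure {F A C : Set Ehat} (hF : (Γ₀).IsUnbalancedFigure B₀ F)
    (hAF : Disjoint A F) {x : Nhat} (hx : x ∈ (Γ₀).nodes F)
    (hxA : (x : P) ∈ G.span (Subtype.val '' A)) (hC : A ∪ F ⊆ C) :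
    ¬ G.Indep (Subtype.val '' C) := by
  obtain ⟨e, he, rfl⟩ | ⟨⟨u, w, X, S, e, hp, he, heS, rfl⟩, hB⟩ := hF
  · rw [nodes_singleton] at hx
    rw [← eq_of_isHalfEdge he hx] at hxA
    refine not_indep_of_mem_span Subtype.val_injective hxA (by simpa using hAF) ?_
    rwa [← Set.union_singleton]
  · rw [nodes_insert_eq hp he] at hx
    rw [Set.disjoint_insert_right] at hAF
    have hX := (G.isFlat_span (Subtype.val '' (A ∪ S))).nodes_mem_of_isPath hp
      ((Set.image_mono Set.subset_union_right).trans (G.subset_span _))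
      ⟨x, hx, G.span_mono (Set.image_mono Set.subset_union_left) hxA⟩
    refine not_indep_of_mem_span Subtype.val_injective (T := A ∪ S)
      ((G.isFlat_span _).mem_of_isLink he (hX u hp.left_mem) (hX w hp.right_mem)) ?_ ?_
    · rintro (h | h)
      · exact hAF.1 h
      · exact heS h
    · rwa [← Set.union_insert]

/-- The unbalanced circle spans `u` and `w`. All of the third path but its first link then spans
both ends of that link. -/
theorem not_indep_theta {u w : Nhat} {X₃ : Set Nhat} {S₁ S₂ S₃ : Set Ehat}
    (hC : (Γ₀).IsCircle (S₁ ∪ S₂)) (hB : S₁ ∪ S₂ ∉ B₀) (hu : u ∈ (Γ₀).nodes (S₁ ∪ S₂))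
    (hw : w ∈ (Γ₀).nodes (S₁ ∪ S₂)) (huw : u ≠ w) (h₃ : (Γ₀).IsPath u w X₃ S₃)
    (hS : Disjoint (S₁ ∪ S₂) S₃) : ¬ G.Indep (Subtype.val '' (S₁ ∪ S₂ ∪ S₃)) := by
  obtain ⟨v, e, Y, T, hl, hp, _, rfl, rfl, heT⟩ := h₃.exists_cons huw
  rw [Set.disjoint_insert_right] at hS
  have hspan := fun x (hx : x ∈ (Γ₀).nodes (S₁ ∪ S₂)) =>
    mem_of_isUnbalancedFigure (Or.inr ⟨hC, hB⟩)
      (G.isFlat_span (Subtype.val '' (S₁ ∪ S₂ ∪ T)))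
      ((Set.image_mono Set.subset_union_left).trans (G.subset_span _)) hx
  have hX := (G.isFlat_span (Subtype.val '' (S₁ ∪ S₂ ∪ T))).nodes_mem_of_isPath hp
    ((Set.image_mono Set.subset_union_right).trans (G.subset_span _))
    ⟨w, hp.right_mem, hspan w hw⟩
  refine not_indep_of_mem_span Subtype.val_injective
    ((G.isFlat_span _).mem_of_isLink hl (hspan u hu) (hX v hp.left_mem)) ?_
    (Set.union_insert ..).superset
  rintro (h | h)
  · exact hS.1 h
  · exact heT h

/-! #### The linear class of balanced circles -/

/-- Deleting the links of `S₂` and `S₃` at `u` leaves a spanning tree of the theta graph, whose span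
`t` is the required cross-flat. Balance of the two given circles puts the deleted links back into
`t`. -/
theorem theta_third_mem {u w : Nhat} {X₁ X₂ X₃ : Set Nhat} {S₁ S₂ S₃ : Set Ehat} (huw : u ≠ w)
    (h₁ : (Γ₀).IsPath u w X₁ S₁) (h₂ : (Γ₀).IsPath u w X₂ S₂) (h₃ : (Γ₀).IsPath u w X₃ S₃)
    (h₁₂ : X₁ ∩ X₂ = {u, w}) (h₁₃ : X₁ ∩ X₃ = {u, w}) (h₂₃ : X₂ ∩ X₃ = {u, w})
    (hS : Disjoint S₂ S₃) (hB₂ : S₁ ∪ S₂ ∈ B₀) (hB₃ : S₁ ∪ S₃ ∈ B₀) : S₂ ∪ S₃ ∈ B₀ := by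
  refine ⟨isCircle_union h₂ h₃ huw h₂₃ hS, ?_⟩
  obtain ⟨v₂, e₂, Y₂, T₂, hl₂, hp₂, hu₂, rfl, rfl, -⟩ := h₂.exists_cons huw
  obtain ⟨v₃, e₃, Y₃, T₃, hl₃, hp₃, hu₃, rfl, rfl, -⟩ := h₃.exists_cons huw
  have hY₁₂ : ∀ x ∈ Y₂, x ∈ X₁ → x = w := fun x hx hx' =>
    (h₁₂.subset ⟨hx', Or.inr hx⟩).elim (fun h => absurd (h ▸ hx) hu₂) id
  have hY₁₃ : ∀ x ∈ Y₃, x ∈ X₁ → x = w := fun x hx hx' =>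
    (h₁₃.subset ⟨hx', Or.inr hx⟩).elim (fun h => absurd (h ▸ hx) hu₃) id
  have hY₂₃ : ∀ x ∈ Y₃, x ∈ Y₂ → x = w := fun x hx hx' =>
    (h₂₃.subset ⟨Or.inr hx', Or.inr hx⟩).elim (fun h => absurd (h ▸ hx) hu₃) id
  have hI₀ : G.Indep {(w : P)} := hN.subset (Set.singleton_subset_iff.2 w.2)
  have hw : ∀ x : Nhat, x ≠ w → {(w : P)} ⊆ G.span (Nhat \ {(x : P)}) := fun x hx =>
    Set.singleton_subset_iff.2 (G.subset_span _ ⟨w.2, fun h => hx (Subtype.ext h).symm⟩)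
  -- The tree consists of three paths ending at `w`, added one after another to the single point
  -- `w`.
  have hI := indep_union_path hp₃ (indep_union_path hp₂ (indep_union_path h₁ hI₀
    fun x _ hx => hw x hx) fun x hx hxw => Set.union_subset (hw x hxw)
      (image_subset_span_sdiff fun h => hxw (hY₁₂ x hx (h₁.nodes_subset h))))
    fun x hx hxw => Set.union_subset (Set.union_subset (hw x hxw)
      (image_subset_span_sdiff fun h => hxw (hY₁₃ x hx (h₁.nodes_subset h))))
      (image_subset_span_sdiff fun h => hxw (hY₂₃ x hx (hp₂.nodes_subset h)))
  rw [Set.union_assoc, Set.union_assoc, ← Set.image_union, ← Set.image_union,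
    Set.singleton_union] at hI
  set t := G.span (Subtype.val '' (S₁ ∪ (T₂ ∪ T₃))) with ht
  have hflat : G.IsFlat t := G.isFlat_span _
  have hsub : Subtype.val '' (S₁ ∪ (T₂ ∪ T₃)) ⊆ t := G.subset_span _
  have hS₁ : Subtype.val '' S₁ ⊆ t := (Set.image_mono Set.subset_union_left).trans hsub
  have hT₂ : Subtype.val '' T₂ ⊆ t :=
    (Set.image_mono (Set.subset_union_left.trans Set.subset_union_right)).trans hsub
  have hT₃ : Subtype.val '' T₃ ⊆ t :=
    (Set.image_mono (Set.subset_union_right.trans Set.subset_union_right)).trans hsub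
  have hwt : (w : P) ∉ t := by
    refine hI.notMem_span ?_
    rintro ⟨e, he, hew⟩
    have : ∃ a b, (Γ₀).IsLink e a b := by
      obtain h | h | h := he
      · exact h₁.exists_isLink h
      · exact hp₂.exists_isLink h
      · exact hp₃.exists_isLink h
    obtain ⟨a, b, hl⟩ := this
    exact notMem_of_isLink hl (hew ▸ w.2)
  -- A node of the tree in `t` would bring `w` into `t` along its path; any other node has a
  -- hyperplane containing `t`.
  have hcross : G.IsCrossFlat Nhat t := by
    refine ⟨hflat, Set.disjoint_left.2 fun n hn hnN => ?_⟩
    have hn1 : (⟨n, hnN⟩ : Nhat) ∉ X₁ := fun h =>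
      hwt (hflat.nodes_mem_of_isPath h₁ hS₁ ⟨_, h, hn⟩ w h₁.right_mem)
    have hn2 : (⟨n, hnN⟩ : Nhat) ∉ Y₂ := fun h =>
      hwt (hflat.nodes_mem_of_isPath hp₂ hT₂ ⟨_, h, hn⟩ w hp₂.right_mem)
    have hn3 : (⟨n, hnN⟩ : Nhat) ∉ Y₃ := fun h =>
      hwt (hflat.nodes_mem_of_isPath hp₃ hT₃ ⟨_, h, hn⟩ w hp₃.right_mem)
    refine hN n hnN (span_le_span (image_subset_span_sdiff (hN := hN) (hE := hE)
      (v := ⟨n, hnN⟩) ?_) hn)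
    rw [nodes_union, nodes_union]
    rintro (h | h | h)
    · exact hn1 (h₁.nodes_subset h)
    · exact hn2 (hp₂.nodes_subset h)
    · exact hn3 (hp₃.nodes_subset h)
  have key : ∀ {v : Nhat} {e : Ehat} {Y : Set Nhat} {T : Set Ehat}, (Γ₀).IsLink e u v →
      (Γ₀).IsPath v w Y T → (∀ x ∈ Y, x ∈ X₁ → x = w) → Subtype.val '' T ⊆ t →
      S₁ ∪ insert e T ∈ B₀ → Subtype.val '' (insert e T) ⊆ t := by
    intro v e Y T hl hp hYX hT hB
    have h := hp.append h₁.reverse fun x hx => hYX x hx.1 hx.2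
    obtain ⟨-, t', ht', hsub'⟩ := hB
    have he := mem_span_path_of_isCrossFlat h hl.symm ht' (by
      rwa [← Set.insert_union, Set.union_comm])
    rw [Set.image_insert_eq]
    refine Set.insert_subset (G.span_subset hflat ?_ he) hT
    rw [Set.image_union]
    exact Set.union_subset hT hS₁
  refine ⟨t, hcross, ?_⟩
  rw [Set.image_union]
  exact Set.union_subset (key hl₂ hp₂ hY₁₂ hT₂ hB₂) (key hl₃ hp₃ hY₁₃ hT₃ hB₃)

theorem isBiasedGraph : (Γ₀).IsBiasedGraph B₀ := by
  refine ⟨fun C hC => hC.1, ?_⟩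
  rintro T ⟨u, w, X₁, X₂, X₃, S₁, S₂, S₃, huw, h₁, h₂, h₃, h₁₂, h₁₃, h₂₃, hS₁₂, hS₁₃, hS₂₃, rfl⟩ h
  obtain ⟨C, D, hCD, hset⟩ := Set.encard_eq_two.1 h
  obtain ⟨a, ha⟩ := h₁.nonempty huw
  obtain ⟨b, hb⟩ := h₂.nonempty huw
  obtain ⟨c, hc⟩ := h₃.nonempty huw
  have ha2 := Set.disjoint_left.1 hS₁₂ ha
  have ha3 := Set.disjoint_left.1 hS₁₃ ha
  have hb1 := Set.disjoint_right.1 hS₁₂ hb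
  have hb3 := Set.disjoint_left.1 hS₂₃ hb
  have hc1 := Set.disjoint_right.1 hS₁₃ hc
  have hc2 := Set.disjoint_right.1 hS₂₃ hc
  have n1 : S₁ ∪ S₂ ≠ S₁ ∪ S₃ := fun h => by
    have := h.subset (Or.inr hb); exact this.elim hb1 hb3
  have n2 : S₁ ∪ S₂ ≠ S₂ ∪ S₃ := fun h => by
    have := h.subset (Or.inl ha); exact this.elim ha2 ha3
  have n3 : S₁ ∪ S₃ ≠ S₂ ∪ S₃ := fun h => by
    have := h.subset (Or.inl ha); exact this.elim ha2 ha3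
  have hcirc : ∀ A ∈ B₀, A ⊆ S₁ ∪ S₂ ∪ S₃ → A = S₁ ∪ S₂ ∨ A = S₁ ∪ S₃ ∨ A = S₂ ∪ S₃ := by
    intro A hA hAT
    obtain h | h | h | h := hA.1.leaflessOff.eq_of_subset_theta huw h₁ h₂ h₃ h₁₂ h₁₃ h₂₃
      hS₁₂ hS₁₃ hS₂₃     hA.1.nonempty hAT
    · exact Or.inl h
    · exact Or.inr (Or.inl h)
    · exact Or.inr (Or.inr h)
    -- The whole theta graph is not a circle, since it properly contains the circle `S₁ ∪ S₂`.
    · have hC := isCircle_union h₁ h₂ huw h₁₂ hS₁₂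
      have h' := hA.1.eq_of_leafless hC.leaflessOff hC.nonempty (h ▸ Set.subset_union_left)
      have : c ∈ S₁ ∪ S₂ := by
        rw [h', h]
        exact Or.inr hc
      exact (this.elim hc1 hc2).elim
  have hmem : ∀ A, A ∈ B₀ ∧ A ⊆ S₁ ∪ S₂ ∪ S₃ ↔ A = C ∨ A = D := fun A => by
    have := congrArg (A ∈ ·) hset
    simpa using this
  have s12 : S₁ ∪ S₂ ⊆ S₁ ∪ S₂ ∪ S₃ := Set.subset_union_left
  have s13 : S₁ ∪ S₃ ⊆ S₁ ∪ S₂ ∪ S₃ := Set.union_subset_union_left _ Set.subset_union_left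
  have s23 : S₂ ∪ S₃ ⊆ S₁ ∪ S₂ ∪ S₃ := Set.union_subset_union_left _ Set.subset_union_right
  have t1 : S₁ ∪ S₂ ∈ B₀ → S₁ ∪ S₃ ∈ B₀ → S₂ ∪ S₃ ∈ B₀ :=
    theta_third_mem huw h₁ h₂ h₃ h₁₂ h₁₃ h₂₃ hS₂₃
  have t2 : S₁ ∪ S₂ ∈ B₀ → S₂ ∪ S₃ ∈ B₀ → S₁ ∪ S₃ ∈ B₀ := fun h h' =>
    theta_third_mem huw h₂ h₁ h₃ (by rwa [Set.inter_comm]) h₂₃ h₁₃ hS₁₃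
      (by rwa [Set.union_comm]) h'
  have t3 : S₁ ∪ S₃ ∈ B₀ → S₂ ∪ S₃ ∈ B₀ → S₁ ∪ S₂ ∈ B₀ := fun h h' =>
    theta_third_mem huw h₃ h₁ h₂ (by rwa [Set.inter_comm]) (by rwa [Set.inter_comm]) h₁₂ hS₁₂
      (by rwa [Set.union_comm]) (by rwa [Set.union_comm])
  have hC := (hmem C).2 (Or.inl rfl)
  have hD := (hmem D).2 (Or.inr rfl)
  have m1 := hmem (S₁ ∪ S₂)
  have m2 := hmem (S₁ ∪ S₃)
  have m3 := hmem (S₂ ∪ S₃)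
  have cC := hcirc C hC.1 hC.2
  have cD := hcirc D hD.1 hD.2
  -- What remains is finite logic: of three distinct sets, any two of which being balanced forces
  -- the third, exactly two cannot be balanced.
  clear hcirc hmem hset h
  generalize S₁ ∪ S₂ = A₁ at *
  generalize S₁ ∪ S₃ = A₂ at *
  generalize S₂ ∪ S₃ = A₃ at *
  grind

/-! #### The matroid on the edge set -/

theorem restrictSubtype_indep {I : Set Ehat} :
    (G.matroid.restrictSubtype Ehat).Indep I ↔ G.Indep (Subtype.val '' I) :=
  Matroid.restrictSubtype_indep_iff

theorem restrictSubtype_dep {I : Set Ehat} :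
    (G.matroid.restrictSubtype Ehat).Dep I ↔ ¬ G.Indep (Subtype.val '' I) := by
  rw [Matroid.dep_iff, restrictSubtype_indep]
  simp

theorem finite_of_isCircuit {K : Set Ehat} (hK : (G.matroid.restrictSubtype Ehat).IsCircuit K) :
    K.Finite := by
  obtain ⟨e, he⟩ := hK.nonempty
  have hi := restrictSubtype_indep.1 (hK.sdiff_singleton_indep he)
  have hes : (e : P) ∈ G.span (Subtype.val '' (K \ {e})) := by
    refine mem_span_of_not_indep_insert hi ?_
    rw [← Set.image_insert_eq, Set.insert_sdiff_singleton, Set.insert_eq_of_mem he]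
    exact restrictSubtype_dep.1 hK.dep
  obtain ⟨F, hF, hfin, heF⟩ := G.exists_finite_of_mem_span hes
  obtain ⟨F, hFK, rfl⟩ := Set.subset_image_iff.1 hF
  have hsub : insert e F ⊆ K := Set.insert_subset he (hFK.trans Set.sdiff_subset)
  rw [← hK.eq_of_dep_subset (restrictSubtype_dep.2
    (not_indep_of_mem_span Subtype.val_injective heF (fun h => (hFK h).2 rfl) le_rfl)) hsub]
  exact (hfin.of_finite_image Subtype.val_injective.injOn).insert e

/-- If `e` were the only edge of `K` at `v`, the independent rest of `K` would lie in the hyperplane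
of `v` and `e` would not, so `K` would be independent. -/
theorem leaflessOff_of_isCircuit {K : Set Ehat}
    (hK : (G.matroid.restrictSubtype Ehat).IsCircuit K) : (Γ₀).LeaflessOff ∅ K := by
  intro v _ e he hv
  by_contra! hcon
  have hsub : Subtype.val '' (K \ {e}) ⊆ G.span (Nhat \ {(v : P)}) := by
    refine image_subset_span_sdiff (hN := hN) (hE := hE) fun h => ?_
    obtain ⟨f, hf, hvf⟩ := mem_nodes_iff.1 h
    exact hcon f hf.1 hf.2 hvf
  have hi := indep_insert (restrictSubtype_indep.1 (hK.sdiff_singleton_indep he))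
    fun h => mem_ends_iff.1 hv (span_le_span hsub h)
  rw [← Set.image_insert_eq, Set.insert_sdiff_singleton, Set.insert_eq_of_mem he] at hi
  exact restrictSubtype_dep.1 hK.dep hi

theorem not_indep_of_mem_balancedCircles {C : Set Ehat} (hC : C ∈ B₀) :
    ¬ G.Indep (Subtype.val '' C) := by
  obtain ⟨⟨u, w, X, S, e, hp, he, heS, rfl⟩, t, ht, hsub⟩ := hC
  exact not_indep_of_mem_span Subtype.val_injective (mem_span_path_of_isCrossFlat hp he ht hsub) heS
    le_rfl

theorem isCircuit_of_forall {C : Set Ehat} (hC : ¬ G.Indep (Subtype.val '' C))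
    (h : ∀ K ⊆ C, (G.matroid.restrictSubtype Ehat).IsCircuit K → K = C) :
    (G.matroid.restrictSubtype Ehat).IsCircuit C := by
  obtain ⟨K, hKC, hK⟩ := (restrictSubtype_dep.2 hC).exists_isCircuit_subset
  exact h K hKC hK ▸ hK

theorem eq_of_isCircuit_subset_circle {C K : Set Ehat}
    (hK : (G.matroid.restrictSubtype Ehat).IsCircuit K) (hC : (Γ₀).IsCircle C) (hKC : K ⊆ C) :
    K = C :=
  hC.eq_of_leafless (leaflessOff_of_isCircuit hK) hK.nonempty hKC

theorem not_isCircuit_subset_figure {F K : Set Ehat} (hF : (Γ₀).IsUnbalancedFigure B₀ F)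
    (hK : (G.matroid.restrictSubtype Ehat).IsCircuit K) : ¬ K ⊆ F :=
  fun h => restrictSubtype_dep.1 hK.dep ((indep_figure hF).subset (Set.image_mono h))

/-- A circuit inside the theta graph is leafless, so it is one of the three circles or everything;
the circles are unbalanced, hence independent. -/
theorem isCircuit_theta {C : Set Ehat} (hC : (Γ₀).IsTheta C) (hB : ∀ D ∈ B₀, ¬ D ⊆ C) :
    (G.matroid.restrictSubtype Ehat).IsCircuit C := by
  obtain ⟨u, w, X₁, X₂, X₃, S₁, S₂, S₃, huw, h₁, h₂, h₃, h₁₂, h₁₃, h₂₃, hS₁₂, hS₁₃, hS₂₃, rfl⟩ := hC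
  have c12 := isCircle_union h₁ h₂ huw h₁₂ hS₁₂
  have c13 := isCircle_union h₁ h₃ huw h₁₃ hS₁₃
  have c23 := isCircle_union h₂ h₃ huw h₂₃ hS₂₃
  have s12 : S₁ ∪ S₂ ⊆ S₁ ∪ S₂ ∪ S₃ := Set.subset_union_left
  have s13 : S₁ ∪ S₃ ⊆ S₁ ∪ S₂ ∪ S₃ := Set.union_subset_union_left _ Set.subset_union_left
  have s23 : S₂ ∪ S₃ ⊆ S₁ ∪ S₂ ∪ S₃ := Set.union_subset_union_left _ Set.subset_union_right
  have hmem : ∀ {x}, x ∈ (Γ₀).nodes S₁ → x ∈ (Γ₀).nodes (S₁ ∪ S₂) := fun h => by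
    rw [nodes_union]; exact Or.inl h
  obtain ⟨_, e, _, T, hl, -, -, -, hT, -⟩ := h₁.exists_cons huw
  obtain ⟨_, f, _, U, hm, -, -, -, hU, -⟩ := h₁.reverse.exists_cons huw.symm
  refine isCircuit_of_forall (not_indep_theta c12 (fun h => hB _ h s12)
    (hmem (mem_nodes (hT ▸ Or.inl rfl) hl.left_mem))
    (hmem (mem_nodes (hU ▸ Or.inl rfl) hm.left_mem)) huw h₃
    (Set.disjoint_union_left.2 ⟨hS₁₃, hS₂₃⟩)) fun K hKC hK => ?_
  have hleaf : (Γ₀).LeaflessOff ∅ K := leaflessOff_of_isCircuit hK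
  obtain h | h | h | h := hleaf.eq_of_subset_theta huw h₁ h₂ h₃ h₁₂ h₁₃ h₂₃ hS₁₂ hS₁₃ hS₂₃
      hK.nonempty hKC
  · exact absurd h.subset (not_isCircuit_subset_figure (Or.inr ⟨c12, fun h => hB _ h s12⟩) hK)
  · exact absurd h.subset (not_isCircuit_subset_figure (Or.inr ⟨c13, fun h => hB _ h s13⟩) hK)
  · exact absurd h.subset (not_isCircuit_subset_figure (Or.inr ⟨c23, fun h => hB _ h s23⟩) hK)
  · exact h

/-- If `K` misses an edge of `F₂`, what is left of `F₂` is at most a path attached at `w`. It peels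
off, then the connecting path does, and `K` falls into the independent `F₁`. -/
theorem figure_subset_of_isCircuit {F₁ F₂ S K : Set Ehat} {u w : Nhat} {X : Set Nhat}
    (hF₁ : (Γ₀).IsUnbalancedFigure B₀ F₁) (hF₂ : (Γ₀).IsUnbalancedFigure B₀ F₂)
    (hp : (Γ₀).IsPath u w X S) (hu : (Γ₀).nodes F₁ ∩ X = {u}) (hw : (Γ₀).nodes F₂ ∩ X = {w})
    (hX : (Γ₀).nodes F₁ ∩ (Γ₀).nodes F₂ ⊆ X)
    (hK : (G.matroid.restrictSubtype Ehat).IsCircuit K) (hKC : K ⊆ F₁ ∪ F₂ ∪ S) : F₂ ⊆ K := by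
  by_contra hcon
  obtain ⟨e, heF, heK⟩ := Set.not_subset.1 hcon
  have hleaf : (Γ₀).LeaflessOff ∅ K := leaflessOff_of_isCircuit hK
  have h1 : K ⊆ F₁ ∪ S := by
    obtain ⟨f, hf, rfl⟩ | ⟨hC, hB⟩ := hF₂
    · intro g hg
      obtain (h | h) | h := hKC hg
      · exact Or.inl h
      · rw [Set.mem_singleton_iff] at heF h
        exact absurd (heF.trans h.symm ▸ hg) heK
      · exact Or.inr h
    · obtain ⟨a, b, Y, T, hT, hl, -, rfl⟩ := hC.exists_path heF
      rw [nodes_insert_eq hT hl] at hw hX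
      refine hleaf.subset_of_path hT (v := w) (fun g hg => ?_) ?_
      · have hge : g ≠ e := fun h => heK (h ▸ hg)
        have := hKC hg
        simp only [Set.mem_union, Set.mem_insert_iff] at this ⊢
        tauto
      · rw [nodes_union]
        rintro x ⟨hx | hx, hxY⟩
        · exact hw.subset ⟨hxY, hX ⟨hx, hxY⟩⟩
        · exact hw.subset ⟨hxY, hp.nodes_subset hx⟩
  exact not_isCircuit_subset_figure hF₁ hK (hleaf.subset_of_path hp h1 hu.subset)

/-- Both kinds of handcuff are treated together: two figures with one common node are the case of a
path of length zero, which is why `hX` replaces disjointness of the node sets. -/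
theorem isCircuit_handcuff {F₁ F₂ S : Set Ehat} {u w : Nhat} {X : Set Nhat}
    (hF₁ : (Γ₀).IsUnbalancedFigure B₀ F₁) (hF₂ : (Γ₀).IsUnbalancedFigure B₀ F₂)
    (hF : Disjoint F₁ F₂) (hp : (Γ₀).IsPath u w X S) (hu : (Γ₀).nodes F₁ ∩ X = {u})
    (hw : (Γ₀).nodes F₂ ∩ X = {w}) (hX : (Γ₀).nodes F₁ ∩ (Γ₀).nodes F₂ ⊆ X) :
    (G.matroid.restrictSubtype Ehat).IsCircuit (F₁ ∪ F₂ ∪ S) := by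
  have hwF : w ∈ (Γ₀).nodes F₂ := (hw.superset rfl).1
  have huF : u ∈ (Γ₀).nodes F₁ := (hu.superset rfl).1
  refine isCircuit_of_forall ?_ fun K hKC hK => hKC.antisymm ?_
  · refine not_indep_union_figure hF₂ (A := F₁ ∪ S) (Set.disjoint_union_left.2 ⟨hF, ?_⟩) hwF ?_ ?_
    · exact hp.disjoint_of_nodes_inter hw.subset
    · refine (G.isFlat_span _).nodes_mem_of_isPath hp
        ((Set.image_mono Set.subset_union_right).trans (G.subset_span _)) ⟨u, hp.left_mem, ?_⟩ w
        hp.right_mem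
      exact mem_of_isUnbalancedFigure hF₁ (G.isFlat_span _)
        ((Set.image_mono Set.subset_union_left).trans (G.subset_span _)) huF
    · rw [Set.union_right_comm]
  refine Set.union_subset (Set.union_subset ?_ ?_) ?_
  · exact figure_subset_of_isCircuit hF₂ hF₁ hp.reverse hw hu (by rwa [Set.inter_comm]) hK
      (by rwa [Set.union_comm F₂])
  · exact figure_subset_of_isCircuit hF₁ hF₂ hp hu hw hX hK hKC
  -- If `K` misses an edge of the connecting path, both remaining pieces of the path peel off. The
  -- path is then not trivial, so the figures are node-disjoint and their union is independent.
  by_contra hcon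
  obtain ⟨e, he, heK⟩ := Set.not_subset.1 hcon
  have hleaf : (Γ₀).LeaflessOff ∅ K := leaflessOff_of_isCircuit hK
  have huw : u ≠ w := by
    rintro rfl
    rw [hp.eq_of_self] at he
    exact he
  have hF12 : ∀ x ∈ (Γ₀).nodes F₁, x ∉ (Γ₀).nodes F₂ := fun x h h' =>
    huw ((hu.subset ⟨h, hX ⟨h, h'⟩⟩).symm.trans (hw.subset ⟨h', hX ⟨h, h'⟩⟩))
  obtain ⟨a, b, Y, T, Z, U, hY, -, hZ, hYZ, rfl, rfl, -⟩ := hp.split_edge he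
  rw [Set.disjoint_left] at hYZ
  have hsub : K ⊆ F₁ ∪ F₂ := by
    refine hleaf.subset_of_path hY (v := u) (hleaf.subset_of_path hZ (v := w)
      (fun g hg => ?_) ?_) ?_
    · have hge : g ≠ e := fun h => heK (h ▸ hg)
      have := hKC hg
      simp only [Set.mem_union, Set.mem_insert_iff] at this ⊢
      tauto
    · rw [nodes_union, nodes_union]
      rintro x ⟨(hx | hx) | hx, hxZ⟩
      · obtain rfl := hu.subset ⟨hx, Or.inr hxZ⟩
        exact absurd hxZ (hYZ hY.left_mem)
      · exact hw.subset ⟨hx, Or.inr hxZ⟩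
      · exact absurd hxZ (hYZ (hY.nodes_subset hx))
    · rw [nodes_union]
      rintro x ⟨hx | hx, hxY⟩
      · exact hu.subset ⟨hx, Or.inl hxY⟩
      · obtain rfl := hw.subset ⟨hx, Or.inl hxY⟩
        exact absurd hZ.right_mem (hYZ hxY)
  refine restrictSubtype_dep.1 hK.dep (Indep.subset ?_ (Set.image_mono hsub))
  rw [Set.image_union]
  exact indep_union_figure hF₂ (indep_figure hF₁) fun x hx =>
    image_subset_span_sdiff fun h => hF12 x h hx

theorem isCircuit_of_isFrameCircuit {C : Set Ehat} (hC : (Γ₀).IsFrameCircuit B₀ C) :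
    (G.matroid.restrictSubtype Ehat).IsCircuit C := by
  obtain ⟨hC, hB⟩ | ⟨hC, hB⟩ | ⟨F₁, F₂, v, hF₁, hF₂, hF, hv, rfl⟩ |
    ⟨F₁, F₂, u, w, X, S, hF₁, hF₂, hF, hp, hu, hw, rfl⟩ := hC
  · exact isCircuit_of_forall (not_indep_of_mem_balancedCircles hB)
      fun K hKC hK => eq_of_isCircuit_subset_circle hK hC hKC
  · exact isCircuit_theta hC hB
  · have hv' := hv.superset rfl
    have := isCircuit_handcuff hF₁ hF₂ hF (.nil v)
      (Set.inter_eq_right.2 (Set.singleton_subset_iff.2 hv'.1))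
      (Set.inter_eq_right.2 (Set.singleton_subset_iff.2 hv'.2)) hv.subset
    rwa [Set.union_empty] at this
  · refine isCircuit_handcuff hF₁ hF₂ ?_ hp hu hw (by simp [hF.inter_eq])
    rw [Set.disjoint_left]
    intro e he he'
    obtain ⟨v, hv⟩ := (Γ₀).exists_mem_ends e
    exact Set.disjoint_left.1 hF (mem_nodes he hv) (mem_nodes he' hv)

theorem exists_isFrameCircuit {K : Set Ehat}
    (hK : (G.matroid.restrictSubtype Ehat).IsCircuit K) : ∃ C ⊆ K, (Γ₀).IsFrameCircuit B₀ C := by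
  by_cases hB : ∃ D ∈ B₀, D ⊆ K
  · obtain ⟨D, hD, hDK⟩ := hB
    exact ⟨D, hDK, Or.inl ⟨hD.1, hD⟩⟩
  push Not at hB
  have hleaf : (Γ₀).LeaflessOff ∅ K := leaflessOff_of_isCircuit hK
  have hfin := finite_of_isCircuit hK
  have hfig : ∃ F ⊆ K, F.Nonempty ∧ (Γ₀).IsUnbalancedFigure B₀ F := by
    obtain ⟨e, he⟩ := hK.nonempty
    obtain ⟨v, hv⟩ := (Γ₀).exists_mem_ends e
    obtain ⟨f, hf, hh⟩ | ⟨C, hCK, hC⟩ :=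
      (hleaf.mono (Set.empty_subset {v})).exists_figure hfin he hv
    · exact ⟨{f}, Set.singleton_subset_iff.2 hf, Set.singleton_nonempty f, Or.inl ⟨f, hh, rfl⟩⟩
    · exact ⟨C, hCK, hC.nonempty, Or.inr ⟨hC, fun h => hB C h hCK⟩⟩
  obtain ⟨F, hFK, ⟨e, he⟩, hF⟩ := hfig
  by_cases htouch : ∃ f ∈ K, f ∉ F ∧ ∃ x ∈ (Γ₀).ends f, x ∈ (Γ₀).nodes F
  · obtain ⟨f, hf, hfF, x, hxf, hx⟩ := htouch
    exact hleaf.exists_frameCircuit hfin hB hF hFK hf hfF hxf hx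
  push Not at htouch
  -- If no other edge of `K` touches `F`, the points of `K \ F` lie in the hyperplane of every node
  -- of `F`, and `K` would be independent.
  have hi : G.Indep (Subtype.val '' (K \ F)) :=
    (restrictSubtype_indep.1 (hK.sdiff_singleton_indep (hFK he))).subset
      (Set.image_mono fun f hf => ⟨hf.1, fun h => hf.2 (h ▸ he)⟩)
  have := indep_union_figure hF hi fun x hx => image_subset_span_sdiff fun h => by
    obtain ⟨f, hf, hxf⟩ := mem_nodes_iff.1 h
    exact htouch f hf.1 hf.2 x hxf hx
  rw [← Set.image_union, Set.sdiff_union_of_subset hFK] at this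
  exact absurd this (restrictSubtype_dep.1 hK.dep)

theorem isFrameMatroid : (Γ₀).IsFrameMatroid B₀ (G.matroid.restrictSubtype Ehat) := by
  refine ⟨Matroid.restrictSubtype_ground, fun C => ⟨fun hC => ?_, isCircuit_of_isFrameCircuit⟩⟩
  obtain ⟨D, hDC, hD⟩ := exists_isFrameCircuit (hN := hN) (hE := hE) hC
  rwa [← hC.eq_of_dep_subset (isCircuit_of_isFrameCircuit hD).dep hDC]

/-! #### Balanced flats and cross-flats -/

/-- Turns matroid flats into traces of projective flats. A basis of `S` has the same span as `S`,
which reduces the claim to independent sets. -/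
theorem restrictSubtype_closure (S : Set Ehat) :
    (G.matroid.restrictSubtype Ehat).closure S =
      Subtype.val ⁻¹' G.span (Subtype.val '' S) := by
  have key : ∀ {I : Set Ehat}, (G.matroid.restrictSubtype Ehat).Indep I →
      (G.matroid.restrictSubtype Ehat).closure I =
        Subtype.val ⁻¹' G.span (Subtype.val '' I) := by
    intro I hI
    ext x
    rw [hI.mem_closure_iff, restrictSubtype_dep, Set.image_insert_eq]
    constructor
    · rintro (h | h)
      · exact mem_span_of_not_indep_insert (restrictSubtype_indep.1 hI) h
      · exact G.subset_span _ ⟨x, h, rfl⟩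
    · intro h
      by_cases hx : x ∈ I
      · exact Or.inr hx
      · refine Or.inl fun h' => h'.notMem_span (fun h => hx ?_) h
        exact Subtype.val_injective.mem_set_image.1 h
  obtain ⟨I, hI⟩ := (G.matroid.restrictSubtype Ehat).exists_isBasis S (by simp)
  rw [← hI.closure_eq_closure, key hI.indep]
  refine congrArg _ ((G.span_mono (Set.image_mono hI.subset)).antisymm (span_le_span ?_))
  rintro _ ⟨x, hx, rfl⟩
  have : x ∈ (G.matroid.restrictSubtype Ehat).closure I := hI.subset_closure hx
  rwa [key hI.indep] at this

theorem isFlat_preimage {t : Set P} (ht : G.IsFlat t) :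
    (G.matroid.restrictSubtype Ehat).IsFlat (Subtype.val ⁻¹' t) := by
  rw [Matroid.isFlat_iff_closure_eq, restrictSubtype_closure]
  refine Set.Subset.antisymm ?_ fun x hx => G.subset_span _ ⟨x, hx, rfl⟩
  exact Set.preimage_mono (G.span_subset ht (Set.image_preimage_subset _ _))

theorem isBalanced_preimage {t : Set P} (ht : G.IsCrossFlat Nhat t) :
    (Γ₀).IsBalanced B₀ (Subtype.val ⁻¹' t) :=
  ⟨fun _ he hh => Set.disjoint_left.1 ht.2 he (isHalfEdge_iff.1 hh),
    fun _ hC hCt => ⟨hC, t, ht, Set.image_subset_iff.2 hCt⟩⟩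

theorem isCrossFlat_span_of_isBalanced {S : Set Ehat} (hS : (Γ₀).IsBalanced B₀ S) :
    G.IsCrossFlat Nhat (G.span (Subtype.val '' S)) := by
  refine ⟨G.isFlat_span _, Set.disjoint_left.2 fun n hn hnN => ?_⟩
  obtain ⟨F, hF, hfin, hnF⟩ := G.exists_finite_of_mem_span hn
  obtain ⟨F, hFS, rfl⟩ := Set.subset_image_iff.1 hF
  -- `K` is a minimal subset of the finite set `F` that still spans `n`. Minimality makes it
  -- independent.
  have hfin' : {K : Set Ehat | K ⊆ F ∧ n ∈ G.span (Subtype.val '' K)}.Finite :=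
    (hfin.of_finite_image Subtype.val_injective.injOn).finite_subsets.subset fun _ h => h.1
  obtain ⟨K, -, hK⟩ := hfin'.exists_le_minimal (a := F) ⟨le_rfl, hnF⟩
  have hmin : ∀ e ∈ K, n ∉ G.span (Subtype.val '' (K \ {e})) := fun e he h =>
    (hK.2 ⟨Set.sdiff_subset.trans hK.1.1, h⟩ Set.sdiff_subset he).2 rfl
  have hinsert : ∀ e ∈ K, insert (e : P) (Subtype.val '' (K \ {e})) = Subtype.val '' K :=
    fun e he => by
      rw [← Set.image_insert_eq, Set.insert_sdiff_singleton, Set.insert_eq_of_mem he]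
  have hKi : G.Indep (Subtype.val '' K) := by
    rintro _ ⟨e, he, rfl⟩ h
    rw [← Set.image_singleton, ← Set.image_sdiff Subtype.val_injective] at h
    refine hmin e he (span_le_span ?_ hK.1.2)
    rw [← hinsert e he]
    exact Set.insert_subset h (G.subset_span _)
  -- At a leaf `v ≠ n` with edge `e`, exchange would put `e` into the span of `n` and `K \ {e}`, all
  -- of which lie in the hyperplane of `v`.
  have hleaf : (Γ₀).LeaflessOff {⟨n, hnN⟩} K := by
    intro v hv e he hve
    by_contra! hcon
    have hsub : Subtype.val '' (K \ {e}) ⊆ G.span (Nhat \ {(v : P)}) := by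
      refine image_subset_span_sdiff (hN := hN) (hE := hE) fun h => ?_
      obtain ⟨f, hf, hvf⟩ := mem_nodes_iff.1 h
      exact hcon f hf.1 hf.2 hvf
    have hns := hK.1.2
    rw [← hinsert e he] at hns
    refine mem_ends_iff.1 hve (span_le_span (Set.insert_subset ?_ hsub)
      (G.exchange hns (hmin e he)))
    exact G.subset_span _ ⟨hnN, fun h => hv (Subtype.ext (Eq.symm h))⟩
  have htouch : (⟨n, hnN⟩ : Nhat) ∈ (Γ₀).nodes K := by
    by_contra h
    exact hN n hnN (span_le_span (image_subset_span_sdiff h) hK.1.2)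
  obtain ⟨f, hf, hnf⟩ := mem_nodes_iff.1 htouch
  obtain ⟨e, he, hh⟩ | ⟨C, hCK, hC⟩ := hleaf.exists_figure
    ((hfin.of_finite_image Subtype.val_injective.injOn).subset hK.1.1) hf hnf
  · exact hS.1 e (hFS (hK.1.1 he)) hh
  · exact not_indep_of_mem_balancedCircles (hS.2 C hC (hCK.trans (hK.1.1.trans hFS)))
      (hKi.subset (Set.image_mono hCK))

end ProjGeom

/-! ### Assembly of (a) and (b) -/

theorem mainTheorem1 {P : Type*} (G : ProjGeom P) (Nhat Ehat : Set P) (hN : G.Indep Nhat)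
    (hE : Ehat ⊆ G.fullEdgePoints Nhat) :
    (G.edgePointGraph hN hE).IsBiasedGraph (G.balancedCircles hN hE) ∧
    ∃ M : Matroid Ehat,
      (G.edgePointGraph hN hE).IsFrameMatroid (G.balancedCircles hN hE) M ∧
      M.map Subtype.val Subtype.val_injective.injOn = G.matroid.restrict Ehat ∧
      {S : Set Ehat | M.IsFlat S ∧
          (G.edgePointGraph hN hE).IsBalanced (G.balancedCircles hN hE) S} =
        {S : Set Ehat | ∃ t, G.IsCrossFlat Nhat t ∧ S = Subtype.val ⁻¹' t} := by
  refine ⟨ProjGeom.isBiasedGraph, G.matroid.restrictSubtype Ehat, ProjGeom.isFrameMatroid,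
    Matroid.map_val_restrictSubtype_eq _ _, Set.ext fun S => ⟨?_, ?_⟩⟩
  · rintro ⟨hS, hbal⟩
    refine ⟨_, ProjGeom.isCrossFlat_span_of_isBalanced hbal, ?_⟩
    rw [← ProjGeom.restrictSubtype_closure, hS.closure]
  · rintro ⟨t, ht, rfl⟩
    exact ⟨ProjGeom.isFlat_preimage ht.1, ProjGeom.isBalanced_preimage ht⟩
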